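/- Let $V=(V,Y,\mathbf 1,\omega)$ be a vertex operator algebra over $\mathbb C$: a vertex algebra with a $\mathbb Z$-grading $V=\bigoplus_{n\in\mathbb Z}V_{(n)}$ such that $\dim V_{(n)}<\infty$ for all $n$ and $V_{(n)}=0$ for $n$ sufficiently negative, and with a conformal vector $\omega$ such that the operators $L(n)=\omega_{n+1}$ satisfy the Virasoro relations with some central charge $c\in\mathbb C$, $L(0)$ acts on $V_{(n)}$ as the scalar $n$, and $Y(L(-1)v,x)=\frac{d}{dx}Y(v,x)$ for $v\in V$. Let $\phi(x,z)=\frac{x}{1+zx}\in\mathbb C((x))[[z]]$, expanded in nonnegative powers of $z$. A module for $V$ viewed as a vertex algebra is a vector space $W$ with a linear map $Y_W(\cdot,x):V\to \mathrm{Hom}(W,W((x)))$ such that $Y_W(\mathbf 1,x)=1_W$ and, for all $u,v\in V$, the Jacobi identity $$x_0^{-1}\delta\Big(\frac{x_1-x_2}{x_0}\Big)Y_W(u,x_1)Y_W(v,x_2)-x_0^{-1}\delta\Big(\frac{x_2-x_1}{-x_0}\Big)Y_W(v,x_2)Y_W(u,x_1)=x_2^{-1}\delta\Big(\frac{x_1-x_0}{x_2}\Big)Y_W(Y(u,x_0)v,x_2)$$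 holds. A $\phi$-coordinated $V$-module is a vector space $W$ with a linear map $Y_W(\cdot,x):V\to \mathrm{Hom}(W,W((x)))$ such that $Y_W(\mathbf 1,x)=1_W$ and for all $u,v\in V$ there is $k\in\mathbb N$ with $$(x_1-x_2)^kY_W(u,x_1)Y_W(v,x_2)\in \mathrm{Hom}(W,W((x_1,x_2))),$$ $$\big((x_1-x_2)^kY_W(u,x_1)Y_W(v,x_2)\big)\big|_{x_1=\phi(x_2,z)}=(\phi(x_2,z)-x_2)^k\,Y_W(Y(u,z)v,x_2).$$ In both cases a homomorphism from $(W_1,Y_{W_1})$ to $(W_2,Y_{W_2})$ is a linear map $\theta:W_1\to W_2$ with $\theta(Y_{W_1}(v,x)w)=Y_{W_2}(v,x)\theta(w)$ for all $v\in V$, $w\in W_1$. Let $W$ be a vector space equipped with a linear map $Y_W(\cdot,x):V\to \mathrm{Hom}(W,W((x)))$ such that $Y_W(\mathbf 1,x)=1_W$. For $v\in V$ set $$Y_W^{new}(v,x)=Y_W\big(e^{xL(1)}(-x^{-2})^{L(0)}v,x\big).$$ Then $(W,Y_W)$ is a $\phi$-coordinated $V$-module if and only if $(W,Y_W^{new})$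 is a module for $V$ viewed as a vertex algebra. Furthermore, the assignment $(W,Y_W)\mapsto (W,Y_W^{new})$ on objects, together with $\theta\mapsto\theta$ on homomorphisms, is an isomorphism from the category of $\phi$-coordinated $V$-modules to the category of modules for $V$ viewed as a vertex algebra. -/

import Mathlib

open CategoryTheory

universe u v

noncomputable section

namespace VertexOp

/-! ### Vertex algebras, vertex operator algebras and modules

A linear map `V → Hom(W, W((x)))` is a linear map `V →ₗ[ℂ] VertexOperator ℂ W`.  For such a map `Y`
the operator `v_n`, that is, the coefficient of `x ^ (-n - 1)` in `Y(v, x)`, is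
`VertexOperator.ncoeff (Y v) n`, and the coefficient of `x ^ n` is `HVertexOperator.coeff (Y v) n`. -/

section Modules

variable {V : Type u} [AddCommGroup V] [Module ℂ V] {W : Type v} [AddCommGroup W] [Module ℂ W]

/-- `Y_W(e, x) = 1_W`. -/
def IsVacuum (e : V) (YW : V →ₗ[ℂ] VertexOperator ℂ W) : Prop :=
  ∀ n : ℤ, HVertexOperator.coeff (YW e) n = if n = 0 then LinearMap.id else 0

/-- The Jacobi identity
`x₀⁻¹ δ((x₁ - x₂)/x₀) Y_W(u, x₁) Y_W(v, x₂) - x₀⁻¹ δ((x₂ - x₁)/(-x₀)) Y_W(v, x₂) Y_W(u, x₁)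
  = x₂⁻¹ δ((x₁ - x₀)/x₂) Y_W(Y(u, x₀)v, x₂)`,
as the equality, on every vector `w`, of the coefficients of `x₀^(-l-1) x₁^(-m-1) x₂^(-n-1)`.
All the sums are finite, since `Y(u, x)v` and `Y_W(u, x)w` are truncated. -/
def JacobiIdentity (Y : V →ₗ[ℂ] VertexOperator ℂ V) (YW : V →ₗ[ℂ] VertexOperator ℂ W) : Prop :=
  ∀ (a b : V) (w : W) (l m n : ℤ),
    (∑ᶠ i : ℕ, ((-1 : ℂ) ^ i * ((Ring.choose l i : ℤ) : ℂ)) •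
        VertexOperator.ncoeff (YW a) (m + l - i) (VertexOperator.ncoeff (YW b) (n + i) w))
      - (∑ᶠ i : ℕ, ((-1 : ℂ) ^ l * (-1 : ℂ) ^ i * ((Ring.choose l i : ℤ) : ℂ)) •
        VertexOperator.ncoeff (YW b) (n + l - i) (VertexOperator.ncoeff (YW a) (m + i) w))
      = ∑ᶠ i : ℕ, ((Ring.choose m i : ℤ) : ℂ) •
        VertexOperator.ncoeff (YW (VertexOperator.ncoeff (Y a) (l + i) b)) (m + n - i) w

end Modules

/-- A vertex algebra structure on the complex vector space `V`. -/
structure VertexAlgebra (V : Type u) [AddCommGroup V] [Module ℂ V] where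
  /-- The vertex operator map `Y(·, x) : V → Hom(V, V((x)))`. -/
  Y : V →ₗ[ℂ] VertexOperator ℂ V
  /-- The vacuum vector. -/
  one : V
  vacuum : IsVacuum one Y
  /-- `Y(v, x)1 ∈ V[[x]]`. -/
  creation_regular : ∀ (a : V) (n : ℤ), n < 0 → HVertexOperator.coeff (Y a) n one = 0
  /-- The constant term of `Y(v, x)1` is `v`. -/
  creation_limit : ∀ a : V, HVertexOperator.coeff (Y a) 0 one = a
  jacobi : JacobiIdentity Y Y

/-- A vertex operator algebra structure on the complex vector space `V`; here `L(n) = ω_{n+1}`. -/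
structure VertexOperatorAlgebra (V : Type u) [AddCommGroup V] [Module ℂ V] extends
    VertexAlgebra V where
  /-- The conformal vector. -/
  ω : V
  /-- The central charge. -/
  c : ℂ
  /-- The homogeneous subspaces `V_(n)`. -/
  gr : ℤ → Submodule ℂ V
  isInternal : DirectSum.IsInternal gr
  finiteDimensional : ∀ n, FiniteDimensional ℂ (gr n)
  lower_truncation : ∃ N : ℤ, ∀ n < N, gr n = ⊥
  virasoro : ∀ m n : ℤ,
    ⁅VertexOperator.ncoeff (Y ω) (m + 1), VertexOperator.ncoeff (Y ω) (n + 1)⁆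
      = ((m : ℂ) - n) • VertexOperator.ncoeff (Y ω) (m + n + 1)
        + (if m + n = 0 then (((m : ℂ) ^ 3 - m) / 12 * c) • (1 : Module.End ℂ V) else 0)
  /-- `L(0)` acts on `V_(n)` as `n`. -/
  L_zero : ∀ (n : ℤ), ∀ a ∈ gr n, VertexOperator.ncoeff (Y ω) 1 a = (n : ℂ) • a
  /-- `Y(L(-1)v, x) = (d/dx) Y(v, x)`. -/
  L_neg_one : ∀ (a : V) (n : ℤ),
    HVertexOperator.coeff (Y (VertexOperator.ncoeff (Y ω) 0 a)) n
      = ((n : ℂ) + 1) • HVertexOperator.coeff (Y a) (n + 1)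

section Modules

variable {V : Type u} [AddCommGroup V] [Module ℂ V] {W : Type v} [AddCommGroup W] [Module ℂ W]

/-- `(W, Y_W)` is a module for the vertex algebra `V`. -/
structure IsModule (A : VertexAlgebra V) (YW : V →ₗ[ℂ] VertexOperator ℂ W) : Prop where
  vacuum : IsVacuum A.one YW
  jacobi : JacobiIdentity A.Y YW

/-! ### `φ`-coordinated modules

A doubly infinite series `∑ a_{m,n} x₁^m x₂^n` with coefficients in `W` is its coefficient function
`ℤ → ℤ → W`. -/

/-- `(x₁ - x₂)^k Y_W(a, x₁) Y_W(b, x₂) w`. -/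
def locProd (YW : V →ₗ[ℂ] VertexOperator ℂ W) (k : ℕ) (a b : V) (w : W) : ℤ → ℤ → W :=
  fun m n => ∑ i ∈ Finset.range (k + 1), ((-1 : ℂ) ^ i * (k.choose i : ℂ)) •
    HVertexOperator.coeff (YW a) (m - (k - i)) (HVertexOperator.coeff (YW b) (n - i) w)

/-- Membership in `W((x₁, x₂)) = W[[x₁, x₂]][x₁⁻¹, x₂⁻¹]`. -/
def IsLaurent₂ (A : ℤ → ℤ → W) : Prop :=
  ∃ N : ℤ, ∀ m n : ℤ, m < N ∨ n < N → A m n = 0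

/-- The variable `x` in `ℂ((x))`. -/
def xVar : LaurentSeries ℂ := HahnSeries.single 1 1

/-- The power `φ^m` in `ℂ((x))[[z]]`, for `φ` with `φ(x, 0) ≠ 0` and an integer `m`. -/
def zpowSeries (φ : PowerSeries (LaurentSeries ℂ)) : ℤ → PowerSeries (LaurentSeries ℂ)
  | Int.ofNat n => φ ^ n
  | Int.negSucc n => φ⁻¹ ^ (n + 1)

/-- The coefficient of `z^l x₂^p` in `A(x₁, x₂)|_{x₁ = φ(x₂, z)} = ∑ a_{m,n} φ(x₂, z)^m x₂^n`, for
`A ∈ W((x₁, x₂))`.  The sum is finite if `φ(x, 0) = x`. -/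
def substCoeff (φ : PowerSeries (LaurentSeries ℂ)) (A : ℤ → ℤ → W) (l p : ℤ) : W :=
  if 0 ≤ l then
    ∑ᶠ mn : ℤ × ℤ,
      (PowerSeries.coeff l.toNat (zpowSeries φ mn.1)).coeff (p - mn.2) • A mn.1 mn.2
  else 0

/-- The coefficient of `z^l x^p` in `ψ(x, z) Y_W(Y(a, z)b, x)w`, for `ψ ∈ ℂ((x))[[z]]`.  The sum is
finite: `Y(a, z)b ∈ V((z))` bounds `i`, and then `Y_W(c, x)w ∈ W((x))` bounds `j` for each `i`. -/
def iterCoeff (Y : V →ₗ[ℂ] VertexOperator ℂ V) (YW : V →ₗ[ℂ] VertexOperator ℂ W)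
    (ψ : PowerSeries (LaurentSeries ℂ)) (a b : V) (w : W) (l p : ℤ) : W :=
  ∑ᶠ ij : ℕ × ℤ, (PowerSeries.coeff ij.1 ψ).coeff ij.2 •
    HVertexOperator.coeff (YW (HVertexOperator.coeff (Y a) (l - ij.1) b)) (p - ij.2) w

/-- `(W, Y_W)` is a `φ`-coordinated module for the vertex algebra `V`, for a series
`φ(x, z) ∈ ℂ((x))[[z]]` with `φ(x, 0) = x` and `φ(φ(x, y), z) = φ(x, y + z)`. -/
structure IsPhiModule (φ : PowerSeries (LaurentSeries ℂ)) (A : VertexAlgebra V)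
    (YW : V →ₗ[ℂ] VertexOperator ℂ W) : Prop where
  vacuum : IsVacuum A.one YW
  assoc : ∀ a b : V, ∃ k : ℕ,
    (∀ w : W, IsLaurent₂ (locProd YW k a b w)) ∧
    ∀ (w : W) (l p : ℤ), substCoeff φ (locProd YW k a b w) l p
      = iterCoeff A.Y YW ((φ - PowerSeries.C xVar) ^ k) a b w l p

end Modules

/-- `φ(x, z) = x / (1 + zx)`, expanded in nonnegative powers of `z`. -/
def phi : PowerSeries (LaurentSeries ℂ) :=
  PowerSeries.C xVar * (1 + PowerSeries.X * PowerSeries.C xVar)⁻¹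

namespace VertexOperatorAlgebra

variable {V : Type u} [AddCommGroup V] [Module ℂ V] (A : VertexOperatorAlgebra V)

/-- `L(n) = ω_{n+1}`. -/
def L (n : ℤ) : Module.End ℂ V := VertexOperator.ncoeff (A.Y A.ω) (n + 1)

/-- The decomposition of a vector into its homogeneous components. -/
def decomp : V ≃ₗ[ℂ] DirectSum ℤ fun n => A.gr n :=
  (LinearEquiv.ofBijective (DirectSum.coeLinearMap A.gr) A.isInternal).symm

theorem decomp_symm_of (m : ℤ) (x : A.gr m) :
    A.decomp.symm (DirectSum.of (fun n => A.gr n) m x) = (x : V) :=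
  DirectSum.coeLinearMap_of A.gr m x

theorem mem_gr_of_L_zero {n : ℤ} {a : V} (h : A.L 0 a = (n : ℂ) • a) : a ∈ A.gr n := by
  classical
  have hL : ∀ d : DirectSum ℤ fun n => A.gr n, A.decomp (A.L 0 (A.decomp.symm d))
      = DirectSum.toModule ℂ ℤ _ (fun m => (m : ℂ) • DirectSum.lof ℂ ℤ (fun n => A.gr n) m) d := by
    intro d
    induction d using DirectSum.induction_on with
    | zero => simp
    | add x y hx hy => simp only [map_add, hx, hy]
    | of m x =>
      have h1 := A.decomp_symm_of m x
      have h2 : A.L 0 (x : V) = (m : ℂ) • (x : V) := by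
        simpa [L] using A.L_zero m x x.2
      rw [h1, h2, map_smul, ← h1, LinearEquiv.apply_symm_apply]
      change _ = DirectSum.toModule ℂ ℤ _ _ (DirectSum.lof ℂ ℤ (fun n => A.gr n) m x)
      rw [DirectSum.toModule_lof]
      rfl
  have hc : ∀ (d : DirectSum ℤ fun n => A.gr n) (k : ℤ),
      DirectSum.toModule ℂ ℤ (DirectSum ℤ fun n => A.gr n)
        (fun m => (m : ℂ) • DirectSum.lof ℂ ℤ (fun n => A.gr n) m) d k = (k : ℂ) • d k := by
    intro d k
    induction d using DirectSum.induction_on with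
    | zero => simp
    | add x y hx hy => simp only [map_add, DirectSum.add_apply, hx, hy, smul_add]
    | of m x =>
      change DirectSum.toModule ℂ ℤ (DirectSum ℤ fun n => A.gr n) _
        (DirectSum.lof ℂ ℤ (fun n => A.gr n) m x) k = _
      rw [DirectSum.toModule_lof]
      change (((m : ℂ) • DirectSum.of (fun n => A.gr n) m x : DirectSum ℤ fun n => A.gr n)) k = _
      rw [DirectSum.smul_apply]
      by_cases hk : m = k
      · subst hk; rfl
      · rw [DirectSum.of_eq_of_ne _ _ _ (Ne.symm hk)]; simp
  have h0 : ∀ k, k ≠ n → A.decomp a k = 0 := by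
    intro k hk
    have h1 := hL (A.decomp a)
    rw [LinearEquiv.symm_apply_apply, h, map_smul] at h1
    have h2 := congrArg (fun d => d k) h1
    simp only [hc, DirectSum.smul_apply] at h2
    rw [← sub_eq_zero, ← sub_smul] at h2
    refine (smul_eq_zero.1 h2).resolve_left ?_
    refine sub_ne_zero.2 ?_
    exact_mod_cast Ne.symm hk
  have h3 : A.decomp a = DirectSum.of (fun n => A.gr n) n (A.decomp a n) := by
    ext k
    by_cases hk : k = n
    · subst hk; simp
    · rw [h0 k hk, DirectSum.of_eq_of_ne _ _ _ hk]
  have h4 : a = ((A.decomp a n : A.gr n) : V) := by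
    conv_lhs => rw [← A.decomp.symm_apply_apply a, h3]
    rw [A.decomp_symm_of]
  rw [h4]
  exact (A.decomp a n).2

theorem L_one_mem {n : ℤ} {a : V} (h : a ∈ A.gr n) : A.L 1 a ∈ A.gr (n - 1) := by
  apply A.mem_gr_of_L_zero
  have h1 := congrArg (fun T : Module.End ℂ V => T a) (A.virasoro 0 1)
  have h2 : A.L 0 a = (n : ℂ) • a := by simpa [L] using A.L_zero n a h
  change ⁅A.L 0, A.L 1⁆ a = _ at h1
  rw [Ring.lie_def, LinearMap.sub_apply, Module.End.mul_apply, Module.End.mul_apply, h2,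
    map_smul] at h1
  have h3 : A.L 0 (A.L 1 a) - (n : ℂ) • A.L 1 a = - A.L 1 a := by
    simpa [L] using h1
  rw [sub_eq_iff_eq_add] at h3
  rw [h3]
  push_cast
  rw [sub_smul, one_smul]
  abel

theorem L_one_locally_nilpotent (a : V) : ∃ N : ℕ, ∀ j ≥ N, (A.L 1 ^ j) a = 0 := by
  classical
  obtain ⟨M, hM⟩ := A.lower_truncation
  rw [← A.decomp.symm_apply_apply a]
  induction A.decomp a using DirectSum.induction_on with
  | zero => exact ⟨0, by simp⟩
  | add x y hx hy =>
    obtain ⟨N₁, h₁⟩ := hx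
    obtain ⟨N₂, h₂⟩ := hy
    refine ⟨max N₁ N₂, fun j hj => ?_⟩
    rw [map_add, map_add, h₁ j (le_trans (le_max_left _ _) hj),
      h₂ j (le_trans (le_max_right _ _) hj), add_zero]
  | of m x =>
    have hx := A.decomp_symm_of m x
    have hj : ∀ j : ℕ, (A.L 1 ^ j) (x : V) ∈ A.gr (m - j) := by
      intro j
      induction j with
      | zero => simp
      | succ j ih =>
        rw [pow_succ', Module.End.mul_apply]
        have := A.L_one_mem ih
        rwa [show m - (j : ℤ) - 1 = m - ((j + 1 : ℕ) : ℤ) by push_cast; ring] at this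
    refine ⟨(m - M + 1).toNat, fun j h => ?_⟩
    have h1 := hj j
    rw [hM (m - j) (by omega)] at h1
    rw [hx]
    simpa using h1

theorem expL1_finite (a : V) : (Function.support fun j : ℕ =>
    Finsupp.single (j : ℤ) ((j.factorial : ℂ)⁻¹ • (A.L 1 ^ j) a)).Finite := by
  obtain ⟨N, hN⟩ := A.L_one_locally_nilpotent a
  refine (Set.finite_lt_nat N).subset fun j hj => ?_
  by_contra h
  exact hj (by simp [hN j (not_lt.1 h)])

/-- `e^{xL(1)} v = ∑_j (1/j!) x^j L(1)^j v`, a polynomial in `x` with coefficients in `V`.  An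
element of `V[x, x⁻¹]` is a finitely supported function `ℤ →₀ V`. -/
def expL1 : V →ₗ[ℂ] (ℤ →₀ V) where
  toFun a := ∑ᶠ j : ℕ, Finsupp.single (j : ℤ) ((j.factorial : ℂ)⁻¹ • (A.L 1 ^ j) a)
  map_add' a b := by
    rw [← finsum_add_distrib (A.expL1_finite a) (A.expL1_finite b)]
    simp only [map_add, smul_add, Finsupp.single_add]
  map_smul' r a := by
    simp only [RingHom.id_apply]
    rw [smul_finsum' r (A.expL1_finite a)]
    simp only [map_smul, smul_comm r, Finsupp.smul_single]

/-- `(-x⁻²)^{L(0)} v = ∑_n (-1)^n x^(-2n) v_(n)`, where `v_(n)` is the component of `v` of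
weight `n`. -/
def negInvSqPowL0 : V →ₗ[ℂ] (ℤ →₀ V) :=
  (DirectSum.toModule ℂ ℤ (ℤ →₀ V) fun n =>
    ((-1 : ℂ) ^ n) • (Finsupp.lsingle (-2 * n)).comp (A.gr n).subtype).comp A.decomp.toLinearMap

/-- `e^{xL(1)} (-x⁻²)^{L(0)} v`. -/
def Phi : V →ₗ[ℂ] (ℤ →₀ V) :=
  (Finsupp.lsum ℂ fun i : ℤ =>
    (Finsupp.lmapDomain V ℂ fun j : ℤ => i + j).comp A.expL1).comp A.negInvSqPowL0

/-- `Y_W^new(v, x) = Y_W(e^{xL(1)} (-x⁻²)^{L(0)} v, x)`: if the argument is `∑ a_i x^i`, this is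
`∑ x^i Y_W(a_i, x)`. -/
def newY {W : Type v} [AddCommGroup W] [Module ℂ W] (YW : V →ₗ[ℂ] VertexOperator ℂ W) :
    V →ₗ[ℂ] VertexOperator ℂ W :=
  (Finsupp.lsum ℂ fun i : ℤ =>
    (LinearMap.lsmul (LaurentSeries ℂ) (HahnModule ℤ ℂ W)
      (HahnSeries.single i 1) |>.restrictScalars ℂ).compRight ℂ ∘ₗ YW).comp A.Phi

end VertexOperatorAlgebra

/-! ### The categories of modules -/

/-- A vector space `W` with a linear map `Y_W(·, x) : V → Hom(W, W((x)))`. -/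
structure FieldSpace (V : Type u) [AddCommGroup V] [Module ℂ V] where
  /-- The underlying vector space. -/
  W : Type v
  [addCommGroup : AddCommGroup W]
  [module : Module ℂ W]
  /-- The vertex operator map. -/
  YW : V →ₗ[ℂ] VertexOperator ℂ W

attribute [instance] FieldSpace.addCommGroup FieldSpace.module

namespace FieldSpace

variable {V : Type u} [AddCommGroup V] [Module ℂ V]

/-- A homomorphism: a linear map `θ` with `θ(Y_W(v, x)w) = Y_{W'}(v, x)θ(w)`. -/
@[ext]
structure Hom (M N : FieldSpace.{u, v} V) where
  /-- The underlying linear map. -/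
  map : M.W →ₗ[ℂ] N.W
  comm : ∀ (a : V) (n : ℤ) (w : M.W),
    map (HVertexOperator.coeff (M.YW a) n w) = HVertexOperator.coeff (N.YW a) n (map w)

instance : Category (FieldSpace.{u, v} V) where
  Hom M N := Hom M N
  id M := { map := LinearMap.id, comm := fun _ _ _ => rfl }
  comp f g :=
    { map := g.map.comp f.map
      comm := fun a n w => by rw [LinearMap.comp_apply, f.comm, g.comm, LinearMap.comp_apply] }

end FieldSpace

variable {V : Type u} [AddCommGroup V] [Module ℂ V]

/-- The category of modules for the vertex algebra `V`. -/
abbrev ModCat (A : VertexAlgebra V) :=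
  ObjectProperty.FullSubcategory fun M : FieldSpace.{u, v} V => IsModule A M.YW

/-- The category of `φ`-coordinated modules for the vertex algebra `V`. -/
abbrev PhiModCat (φ : PowerSeries (LaurentSeries ℂ)) (A : VertexAlgebra V) :=
  ObjectProperty.FullSubcategory fun M : FieldSpace.{u, v} V => IsPhiModule φ A M.YW

theorem VertexOperatorAlgebra.coeff_newY (A : VertexOperatorAlgebra V) {W : Type v} [AddCommGroup W]
    [Module ℂ W] (YW : V →ₗ[ℂ] VertexOperator ℂ W) (a : V) (n : ℤ) (w : W) :
    HVertexOperator.coeff (A.newY YW a) n w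
      = (A.Phi a).sum fun i b => HVertexOperator.coeff (YW b) (n - i) w := by
  have h : ∀ (d : ℤ →₀ V), HVertexOperator.coeff ((Finsupp.lsum ℂ fun i : ℤ =>
      (LinearMap.lsmul (LaurentSeries ℂ) (HahnModule ℤ ℂ W)
        (HahnSeries.single i 1) |>.restrictScalars ℂ).compRight ℂ ∘ₗ YW) d) n w
      = d.sum fun i b => HVertexOperator.coeff (YW b) (n - i) w := by
    intro d
    induction d using Finsupp.induction_linear with
    | zero => simp
    | add f g hf hg =>
      rw [Finsupp.sum_add_index' (by simp) (by simp), map_add, map_add, ← hf, ← hg]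
      rfl
    | single i b =>
      rw [Finsupp.lsum_single, Finsupp.sum_single_index (by simp)]
      change ((HahnModule.of ℂ).symm (HahnSeries.single i (1 : ℂ) • (YW b w))).coeff n
        = ((HahnModule.of ℂ).symm (YW b w)).coeff (n - i)
      have := HahnModule.coeff_single_smul_vadd (r := (1 : ℂ)) (x := YW b w) (a := n - i) (b := i)
      simpa using this
  exact h (A.Phi a)

/-- The assignment `(W, Y_W) ↦ (W, Y_W^new)`, identical on linear maps. -/
def newFunctor (A : VertexOperatorAlgebra V) : FieldSpace.{u, v} V ⥤ FieldSpace.{u, v} V where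
  obj M := { W := M.W, YW := A.newY M.YW }
  map {M N} f :=
    { map := f.map
      comm := fun a n w => by
        simp only [A.coeff_newY, Finsupp.sum, map_sum, f.comm] }

end VertexOp

end

namespace VertexOp

/-! ### Finite sums -/

section Sums

variable {M : Type*} [AddCommGroup M]

/-! Put y = x⁻¹. Since 1/φ(x, z) = y + z, the substitution x₁ = φ(x₂, z) reads y₁ = y₂ + z, and
φ-associativity becomes ordinary weak associativity for the fields Y_W(v, y⁻¹) (`isPhiModule_iff`).
On a given vector these fields have powers of y bounded above instead of below, so the matching
Jacobi identity is the one with the operators in the opposite order, `InvJacobi`.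

The two are equivalent by `exists_isInvAssoc_iff`. Associativity for all pairs forces locality
(`IsInvAssoc.isLocal`): the pair with the vacuum gives Y_W(e^{zD}a, x) = Y_W(a, φ(x, z)), skew
symmetry then relates the pairs (a, b) and (b, a), and a Laurent series in two variables is
determined by its substitution y₁ = y₂ + z (`IsLaurent₂.eq_of_moment`). For local fields the two
expansions of (y₁ − y₂)^l differ by a derivative of a delta function (`expand_sub_expand_swap`), so
the components of the reversed Jacobi identity are combinations of the coefficients compared in
associativity, and conversely.

It remains to compare `InvJacobi` for Y_W with the Jacobi identity for Y_W^new, as in the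
construction of contragredient modules. By the conjugation formula for e^{tL(1)} (`dpow_ncoeff`), on
homogeneous a, b the failure of the second identity is, up to sign, the sum over i, j of the
failures of the first at L(1)^i a/i! and L(1)^j b/j! (`jacobiDefect_newY`). As L(1) is locally
nilpotent, this system is unitriangular up to sign, so one family of failures vanishes exactly when
the other does.

The operator e^{xL(1)}(−x⁻²)^{L(0)} is inverted by the same expression in x⁻¹ (`comp_eq`). Both
directions keep W and the linear maps, so the functors are inverse to each other on the nose. -/

theorem hasFiniteSupport_of_le {f : ℕ → M} {N : ℕ} (h : ∀ i, N ≤ i → f i = 0) :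
    f.HasFiniteSupport :=
  (Set.finite_lt_nat N).subset fun i hi => by
    by_contra hc
    exact hi (h i (not_lt.1 hc))

theorem finsum_eq_sum_range {f : ℕ → M} {N : ℕ} (h : ∀ i, N ≤ i → f i = 0) :
    ∑ᶠ i, f i = ∑ i ∈ Finset.range N, f i :=
  finsum_eq_sum_of_support_subset f fun i hi => by
    by_contra hc
    exact hi (h i (by simpa using hc))

/-- Summation along antidiagonals. -/
theorem finsum_sum_antidiagonal {f : ℕ → ℕ → M} {N : ℕ} (h : ∀ i j, N ≤ i + j → f i j = 0) :
    ∑ᶠ n, ∑ ij ∈ Finset.HasAntidiagonal.antidiagonal n, f ij.1 ij.2 = ∑ᶠ i, ∑ᶠ j, f i j := by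
  have h1 : ∀ i, ∑ᶠ j, f i j = ∑ j ∈ Finset.range N, f i j := fun i =>
    finsum_eq_sum_range fun j hj => h i j (by omega)
  rw [finsum_eq_sum_range (N := N) fun n hn => Finset.sum_eq_zero fun ij hij => h _ _ (by
      rw [Finset.HasAntidiagonal.mem_antidiagonal] at hij; omega)]
  simp only [h1]
  rw [finsum_eq_sum_range (N := N) fun n hn => Finset.sum_eq_zero fun j _ => h _ _ (by omega),
    ← Finset.sum_product', Finset.sum_sigma']
  refine Finset.sum_bij_ne_zero (fun x _ _ => x.2) ?_ ?_ ?_ ?_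
  · rintro ⟨n, i, j⟩ h1 h2
    simp only [Finset.mem_sigma, Finset.mem_range, Finset.HasAntidiagonal.mem_antidiagonal] at h1
    simp only [Finset.mem_product, Finset.mem_range]
    omega
  · rintro ⟨n, i, j⟩ h1 _ ⟨n', i', j'⟩ h1' _ h2
    simp only [Finset.mem_sigma, Finset.mem_range, Finset.HasAntidiagonal.mem_antidiagonal] at h1 h1'
    obtain ⟨rfl, rfl⟩ := Prod.mk.inj h2
    obtain rfl : n = n' := by omega
    rfl
  · rintro ⟨i, j⟩ _ h2
    have : i + j < N := by
      by_contra hc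
      exact h2 (h i j (not_lt.1 hc))
    exact ⟨⟨i + j, i, j⟩, by simpa using this, h2, rfl⟩
  · intros; rfl

theorem zsmul_finsum {ι : Type*} (c : ℤ) {f : ι → M} (hf : f.HasFiniteSupport) :
    c • ∑ᶠ i, f i = ∑ᶠ i, c • f i :=
  smul_finsum' c hf

theorem finsum_int_split {f : ℤ → M} (hf : f.HasFiniteSupport) (m : ℤ) :
    ∑ᶠ k, f k = ∑ᶠ i : ℕ, f (m - 1 - i) + ∑ᶠ i : ℕ, f (m + i) := by
  let e₁ : ℕ → ℤ := fun i => m - 1 - i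
  let e₂ : ℕ → ℤ := fun i => m + i
  have i₁ : Function.Injective e₁ := fun i j h => by simp only [e₁] at h; omega
  have i₂ : Function.Injective e₂ := fun i j h => by simp only [e₂] at h; omega
  have hd : Disjoint (Set.range e₁) (Set.range e₂) := by
    rw [Set.disjoint_left]
    rintro _ ⟨i, rfl⟩ ⟨j, h⟩
    simp only [e₁, e₂] at h; omega
  have hu : Set.range e₁ ∪ Set.range e₂ = Set.univ := by
    refine Set.eq_univ_of_forall fun k => ?_
    rcases lt_or_ge k m with h | h
    · exact Or.inl ⟨(m - 1 - k).toNat, by simp only [e₁]; omega⟩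
    · exact Or.inr ⟨(k - m).toNat, by simp only [e₂]; omega⟩
  rw [← finsum_mem_univ, ← hu, finsum_mem_union' hd (hf.subset Set.inter_subset_right)
    (hf.subset Set.inter_subset_right), finsum_mem_range i₁, finsum_mem_range i₂]

theorem finsum_comp_of_injective {ι κ : Type*} {f : κ → M} {e : ι → κ}
    (he : Function.Injective e) (h : ∀ k, f k ≠ 0 → k ∈ Set.range e) :
    ∑ᶠ i, f (e i) = ∑ᶠ k, f k := by
  rw [← finsum_mem_range (f := f) he, ← finsum_mem_univ f]
  refine finsum_mem_inter_support_eq f _ _ ?_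
  ext k
  simpa using h k

theorem finsum_shift {f : ℕ → M} {N : ℕ} (h : ∀ i < N, f i = 0) :
    ∑ᶠ i, f (N + i) = ∑ᶠ i, f i :=
  finsum_comp_of_injective (add_right_injective N) fun k hk => ⟨k - N, by
    have : ¬ k < N := fun hc => hk (h k hc)
    omega⟩

theorem finsum_eq_zero_of_forall {ι : Type*} {f : ι → M} (h : ∀ i, f i = 0) : ∑ᶠ i, f i = 0 :=
  finsum_eq_zero_of_forall_eq_zero h

end Sums

/-! ### Binomial coefficients with integer upper index. -/

section Choose

/-- Chu–Vandermonde. -/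
theorem choose_add (r s : ℤ) (k : ℕ) : Ring.choose (r + s) k
    = ∑ ij ∈ Finset.HasAntidiagonal.antidiagonal k, Ring.choose r ij.1 * Ring.choose s ij.2 :=
  Ring.add_choose_eq k (Commute.all r s)

theorem choose_neg_eq (r : ℤ) (n : ℕ) :
    Ring.choose (-r) n = (-1) ^ n * Ring.choose (r + n - 1) n := by
  rw [Ring.choose_neg, Units.smul_def]
  simp [Int.negOnePow_def]

theorem choose_reflect (r : ℤ) (n : ℕ) :
    Ring.choose r n = (-1) ^ n * Ring.choose (n - 1 - r) n := by
  have := choose_neg_eq (-r) n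
  rw [neg_neg] at this
  rw [this]; congr 2; ring

theorem choose_nat_of_lt {m : ℤ} {n : ℕ} (h0 : 0 ≤ m) (h : m < n) : Ring.choose m n = 0 := by
  lift m to ℕ using h0
  rw [Ring.choose_natCast, Nat.choose_eq_zero_of_lt (by omega)]; rfl

/-- Reflecting the upper indices with `choose_reflect` reduces this to Chu–Vandermonde. It fuses the
binomial of the Jacobi identity with the one of the L(1)-conjugation formula in
`finsum_newY_ncoeff`. -/
theorem sum_choose_mul_choose_sub (m P : ℤ) (R : ℕ) :
    ∑ ij ∈ Finset.HasAntidiagonal.antidiagonal R, (-1) ^ ij.1 * Ring.choose m ij.1 * Ring.choose (P - ij.1) ij.2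
      = Ring.choose (P - m) R := by
  rw [choose_reflect (P - m), show (R : ℤ) - 1 - (P - m) = m + (R - 1 - P) by ring, choose_add,
    Finset.mul_sum]
  refine Finset.sum_congr rfl fun ij hij => ?_
  rw [Finset.HasAntidiagonal.mem_antidiagonal] at hij
  rw [choose_reflect (P - ij.1), ← hij, pow_add]
  push_cast
  rw [show (ij.2 : ℤ) - 1 - (P - ij.1) = ij.1 + ij.2 - 1 - P by ring]
  ring

/-- The binomial coefficient, extended by `0` to negative lower index. -/
def bin (x l : ℤ) : ℤ := if 0 ≤ l then Ring.choose x l.toNat else 0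

theorem bin_nat (x : ℤ) (l : ℕ) : bin x l = Ring.choose x l := by simp [bin]

theorem bin_neg (x : ℤ) {l : ℤ} (h : l < 0) : bin x l = 0 := by simp [bin, h]

theorem bin_succ (x l : ℤ) : bin (x + 1) l = bin x (l - 1) + bin x l := by
  rcases lt_trichotomy l 0 with h | h | h
  · rw [bin_neg _ h, bin_neg _ h, bin_neg _ (by omega)]; rfl
  · subst h
    simp [bin]
  · obtain ⟨n, rfl⟩ : ∃ n : ℕ, l = (n + 1 : ℕ) := ⟨(l - 1).toNat, by omega⟩
    rw [bin_nat, bin_nat, show ((n + 1 : ℕ) : ℤ) - 1 = n by push_cast; ring, bin_nat,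
      Ring.choose_succ_succ]

theorem mul_bin (x l : ℤ) : l * bin x l = (x - l + 1) * bin x (l - 1) := by
  rcases lt_trichotomy l 0 with h | h | h
  · rw [bin_neg _ h, bin_neg _ (by omega), mul_zero, mul_zero]
  · subst h
    simp [bin]
  · obtain ⟨n, rfl⟩ : ∃ n : ℕ, l = (n + 1 : ℕ) := ⟨(l - 1).toNat, by omega⟩
    have h1 := Ring.choose_smul_choose x (Nat.le_succ n)
    rw [Nat.succ_eq_add_one, Nat.choose_succ_self_right, Nat.add_sub_cancel_left,
      Ring.choose_one_right, nsmul_eq_mul] at h1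
    rw [bin_nat, show ((n + 1 : ℕ) : ℤ) - 1 = n by push_cast; ring, bin_nat, h1]
    push_cast
    ring

theorem bin_add (x y l : ℤ) : bin (x + y) l = ∑ᶠ i : ℕ, Ring.choose x i * bin y (l - i) := by
  rcases lt_or_ge l 0 with h | h
  · rw [bin_neg _ h, finsum_eq_zero_of_forall fun i => ?_]
    rw [bin_neg _ (by omega), mul_zero]
  · lift l to ℕ using h
    rw [bin_nat, choose_add, finsum_eq_sum_range (N := l + 1) fun i hi => by
      rw [bin_neg _ (by omega), mul_zero], Finset.Nat.sum_antidiagonal_eq_sum_range_succ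
      (f := fun i j => Ring.choose x i * Ring.choose y j)]
    refine Finset.sum_congr rfl fun i hi => ?_
    rw [Finset.mem_range] at hi
    rw [show (l : ℤ) - i = ((l - i : ℕ) : ℤ) by omega, bin_nat]

end Choose

end VertexOp

/-! ### Expansions of (y₁ − y₂)^L and the substitution y₁ = y₂ + z. -/

namespace VertexOp

section Expand

variable {M : Type*} [AddCommGroup M]

/-- The coefficients of `(y₁ - y₂)^L β`, where `y = x⁻¹` and `(y₁ - y₂)^L` is expanded in
nonnegative powers of `y₂`.  All coefficient functions are indexed by powers of `x₁`, `x₂`. -/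
noncomputable def expand (L : ℤ) (β : ℤ → ℤ → M) : ℤ → ℤ → M := fun m n =>
  ∑ᶠ i : ℕ, ((-1) ^ i * Ring.choose L i : ℤ) • β (m + L - i) (n + i)

theorem expand_expand_of {L K : ℤ} {β : ℤ → ℤ → M} {m n : ℤ} {B : ℕ}
    (h₁ : ∀ i j : ℕ, B ≤ i →
      Ring.choose L i • Ring.choose K j • β (m + (L + K) - (i + j)) (n + (i + j)) = 0)
    (h₂ : ∀ i j : ℕ, B ≤ j → Ring.choose K j • β (m + (L + K) - (i + j)) (n + (i + j)) = 0) :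
    expand L (expand K β) m n = expand (L + K) β m n := by
  have e : ∀ i j : ℕ, m + L - i + K - j = m + (L + K) - (i + j) := fun i j => by ring
  have hterm : ∀ i : ℕ, ((-1) ^ i * Ring.choose L i : ℤ) • expand K β (m + L - i) (n + i)
      = ∑ᶠ j : ℕ, ((-1) ^ (i + j) * (Ring.choose L i * Ring.choose K j) : ℤ)
        • β (m + (L + K) - (i + j)) (n + (i + j)) := by
    intro i
    rw [expand, zsmul_finsum _ (hasFiniteSupport_of_le (N := B) fun j hj => by
      rw [mul_smul, e, add_assoc, h₂ i j hj, smul_zero])]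
    refine finsum_congr fun j => ?_
    rw [smul_smul, e, add_assoc, pow_add]
    congr 1; ring
  rw [expand, finsum_congr hterm, ← finsum_sum_antidiagonal (N := 2 * B) fun i j hij => ?_, expand]
  · refine finsum_congr fun k => ?_
    rw [choose_add, Finset.mul_sum, Finset.sum_smul]
    refine Finset.sum_congr rfl fun ij hij => ?_
    rw [Finset.HasAntidiagonal.mem_antidiagonal] at hij
    subst hij
    push_cast
    rfl
  · rcases le_or_gt B i with h | h
    · rw [mul_smul, mul_smul, h₁ i j h, smul_zero]
    · rw [mul_smul, mul_smul, h₂ i j (by omega), smul_zero, smul_zero]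

theorem expand_expand (L K : ℤ) {β : ℤ → ℤ → M} {N : ℤ} (h : ∀ m n, m < N → β m n = 0) :
    expand L (expand K β) = expand (L + K) β := by
  funext m n
  exact expand_expand_of (B := (m + (L + K) - N + 1).toNat)
    (fun i j hi => by rw [h _ _ (by omega), smul_zero, smul_zero])
    (fun i j hi => by rw [h _ _ (by omega), smul_zero])

theorem choose_nat_eq_zero {k i : ℕ} (h : k + 1 ≤ i) : Ring.choose (k : ℤ) i = 0 :=
  choose_nat_of_lt (by omega) (by omega)

theorem expand_nat (k : ℕ) (β : ℤ → ℤ → M) (m n : ℤ) : expand k β m n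
    = ∑ i ∈ Finset.range (k + 1), ((-1) ^ i * (k.choose i) : ℤ) • β (m + k - i) (n + i) := by
  rw [expand, finsum_eq_sum_range (N := k + 1) fun i hi => by
    rw [choose_nat_eq_zero hi, mul_zero, zero_smul]]
  refine Finset.sum_congr rfl fun i _ => ?_
  rw [Ring.choose_natCast]

theorem expand_succ (k : ℕ) (β : ℤ → ℤ → M) (m n : ℤ) :
    expand (k + 1 : ℕ) β m n = expand k β (m + 1) n - expand k β m (n + 1) := by
  have h : expand (1 + (k : ℤ)) β m n = expand 1 (expand k β) m n := by
    refine (expand_expand_of (B := k + 2) (fun i j hi => ?_) fun i j hj => ?_).symm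
    · rw [show (1 : ℤ) = (1 : ℕ) from rfl, choose_nat_eq_zero (by omega), zero_smul]
    · rw [choose_nat_eq_zero (by omega), zero_smul]
  rw [show ((k + 1 : ℕ) : ℤ) = 1 + (k : ℤ) by push_cast; ring, h]
  conv_lhs => rw [show (1 : ℤ) = (1 : ℕ) from rfl]
  rw [expand_nat]
  simp [Finset.sum_range_succ, sub_eq_add_neg]

/-- Exchange of the two variables. -/
def swap (β : ℤ → ℤ → M) : ℤ → ℤ → M := fun m n => β n m

/-- For a natural exponent (y₂ − y₁)^k is a polynomial, so the direction of expansion is immaterial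
and only the sign (−1)^k remains. -/
theorem expand_nat_swap (k : ℕ) (β : ℤ → ℤ → M) (m n : ℤ) :
    expand k (swap β) n m = ((-1) ^ k : ℤ) • expand k β m n := by
  rw [expand_nat, expand_nat, ← Finset.sum_range_reflect, Finset.smul_sum]
  refine Finset.sum_congr rfl fun i hi => ?_
  rw [Finset.mem_range] at hi
  obtain ⟨j, rfl⟩ : ∃ j, k = i + j := ⟨k - i, by omega⟩
  rw [show i + j + 1 - 1 - i = j by omega, smul_smul, swap, Nat.choose_symm_add, pow_add,
    show m + ((i + j : ℕ) : ℤ) - i = m + j by push_cast; ring,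
    show n + ((i + j : ℕ) : ℤ) - j = n + i by push_cast; ring, ← mul_assoc]
  congr 1
  rw [mul_right_comm _ ((-1 : ℤ) ^ j), ← pow_add, Even.neg_one_pow ⟨i, rfl⟩, one_mul]

theorem expand_zsmul (L c : ℤ) {β : ℤ → ℤ → M} {N : ℤ} (h : ∀ m n, m < N → β m n = 0) :
    expand L (fun m n => c • β m n) = fun m n => c • expand L β m n := by
  funext m n
  rw [expand, expand, zsmul_finsum _ (hasFiniteSupport_of_le (N := (m + L - N + 1).toNat)
    fun i hi => by rw [h _ _ (by omega), smul_zero])]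
  exact finsum_congr fun i => smul_comm _ _ _

/-- The coefficient of `z^l x₂^p` in `A(x₁, x₂)|_{y₁ = y₂ + z}`, where `y = x⁻¹`. -/
noncomputable def moment (A : ℤ → ℤ → M) (l p : ℤ) : M :=
  ∑ᶠ μ : ℤ, bin (-μ) l • A μ (p - l - μ)

theorem IsLaurent₂.hasFiniteSupport {A : ℤ → ℤ → M}
    (hA : IsLaurent₂ A) (c : ℤ → ℤ) (s : ℤ) :
    (fun μ : ℤ => c μ • A μ (s - μ)).HasFiniteSupport := by
  obtain ⟨N, hN⟩ := hA
  refine (Set.finite_Icc N (s - N)).subset fun μ hμ => ?_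
  by_contra hc
  refine hμ ?_
  simp only [Set.mem_Icc, not_and_or, not_le] at hc
  dsimp only
  rw [hN _ _ (by omega), smul_zero]

theorem moment_eq_zero_of_neg (A : ℤ → ℤ → M) {l : ℤ} (hl : l < 0) (p : ℤ) : moment A l p = 0 :=
  finsum_eq_zero_of_forall fun μ => by rw [bin_neg _ hl, zero_smul]

/-- Vandermonde applied to r + (−μ). Binomially weighted sums along an antidiagonal are thereby
combinations of moments; this carries the delta-function, uniqueness and locality arguments. -/
theorem finsum_bin_add {A : ℤ → ℤ → M} (hA : IsLaurent₂ A) (r j s : ℤ) :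
    ∑ᶠ μ : ℤ, bin (r - μ) j • A μ (s - μ)
      = ∑ᶠ i : ℕ, Ring.choose r i • moment A (j - i) (s + j - i) := by
  have h0 : ∀ i : ℕ, j.toNat + 1 ≤ i → ∀ x, bin x (j - i) = 0 := fun i hi x =>
    bin_neg _ (by omega)
  rw [finsum_eq_sum_range (N := j.toNat + 1) fun i hi => by
    rw [moment_eq_zero_of_neg _ (by omega), smul_zero]]
  have h1 : ∀ μ : ℤ, bin (r - μ) j • A μ (s - μ) = ∑ i ∈ Finset.range (j.toNat + 1),
      (Ring.choose r i * bin (-μ) (j - i)) • A μ (s - μ) := by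
    intro μ
    rw [sub_eq_add_neg r, bin_add, finsum_eq_sum_range (N := j.toNat + 1) fun i hi => by
      rw [h0 i hi, mul_zero], Finset.sum_smul]
  rw [finsum_congr h1, finsum_sum_comm _ _ fun i _ => hA.hasFiniteSupport _ _]
  refine Finset.sum_congr rfl fun i _ => ?_
  rw [moment, zsmul_finsum _ (hA.hasFiniteSupport _ _)]
  refine finsum_congr fun μ => ?_
  rw [mul_smul, show s + j - i - (j - i) - μ = s - μ by ring]

theorem IsLaurent₂.expand_succ {β : ℤ → ℤ → M} {k : ℕ} (h : IsLaurent₂ (expand k β)) :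
    IsLaurent₂ (expand (k + 1 : ℕ) β) := by
  obtain ⟨N, hN⟩ := h
  refine ⟨N - 1, fun m n hmn => ?_⟩
  rw [VertexOp.expand_succ, hN _ _ (by omega), hN _ _ (by omega), sub_zero]

/-- Under y₁ = y₂ + z the additional factor y₁ − y₂ becomes z. On coefficients this is Pascal's rule
after a shift of the summation index. -/
theorem moment_expand_succ {β : ℤ → ℤ → M} {k : ℕ} (h : IsLaurent₂ (expand k β)) (l p : ℤ) :
    moment (expand (k + 1 : ℕ) β) l p = moment (expand k β) (l - 1) p := by
  have h1 : ∀ μ : ℤ, bin (-μ) l • expand (k + 1 : ℕ) β μ (p - l - μ)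
      = bin (-μ) l • expand k β (μ + 1) (p - l + 1 - (μ + 1))
        - bin (-μ) l • expand k β μ (p - l + 1 - μ) := by
    intro μ
    rw [expand_succ, smul_sub, show p - l + 1 - (μ + 1) = p - l - μ by ring,
      show p - l + 1 - μ = p - l - μ + 1 by ring]
  let g : ℤ → M := fun μ => bin (1 - μ) l • expand k β μ (p - l + 1 - μ)
  have hg : g.HasFiniteSupport := h.hasFiniteSupport _ _
  have h2 : ∑ᶠ μ : ℤ, bin (-μ) l • expand k β (μ + 1) (p - l + 1 - (μ + 1)) = ∑ᶠ μ, g μ := by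
    rw [← finsum_comp_equiv (Equiv.addRight (1 : ℤ)) (f := g)]
    refine finsum_congr fun μ => ?_
    simp only [g, Equiv.coe_addRight]
    rw [show 1 - (μ + 1) = -μ by ring]
  have h3 : (fun μ : ℤ => bin (-μ) l • expand k β (μ + 1) (p - l + 1 - (μ + 1))).HasFiniteSupport := by
    have := h.hasFiniteSupport (fun μ => bin (1 - μ) l) (p - l + 1)
    refine (this.preimage (f := fun μ : ℤ => μ + 1) (add_left_injective 1).injOn).subset ?_
    intro μ hμ
    simpa [show 1 - (μ + 1) = -μ by ring] using hμ
  rw [moment, finsum_congr h1, finsum_sub_distrib h3 (h.hasFiniteSupport _ _), h2,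
    ← finsum_sub_distrib hg (h.hasFiniteSupport _ _), moment]
  refine finsum_congr fun μ => ?_
  simp only [g]
  rw [← sub_smul, show 1 - μ = -μ + 1 by ring, bin_succ, add_sub_cancel_right,
    show p - (l - 1) - μ = p - l + 1 - μ by ring]

/-- A coefficient function is determined by its moments. -/
theorem IsLaurent₂.eq_of_moment {A B : ℤ → ℤ → M} (hA : IsLaurent₂ A) (hB : IsLaurent₂ B)
    (h : ∀ l p, moment A l p = moment B l p) : A = B := by
  obtain ⟨N, hN⟩ := hA
  obtain ⟨N', hN'⟩ := hB
  have key : ∀ s r j, ∑ᶠ μ : ℤ, bin (r - μ) j • A μ (s - μ)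
      = ∑ᶠ μ : ℤ, bin (r - μ) j • B μ (s - μ) := fun s r j => by
    rw [finsum_bin_add ⟨N, hN⟩, finsum_bin_add ⟨N', hN'⟩]
    simp only [h]
  suffices H : ∀ s μ, A μ (s - μ) = B μ (s - μ) by
    funext m n
    simpa using H (m + n) m
  intro s
  set b := min N N' with hb
  set t := s - b
  have hlow : ∀ μ < b, A μ (s - μ) = B μ (s - μ) := fun μ hμ => by
    rw [hN _ _ (by omega), hN' _ _ (by omega)]
  have hhigh : ∀ μ > t, A μ (s - μ) = B μ (s - μ) := fun μ hμ => by
    rw [hN _ _ (by omega), hN' _ _ (by omega)]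
  have hind : ∀ d : ℕ, ∀ μ < b + d, A μ (s - μ) = B μ (s - μ) := by
    intro d
    induction d with
    | zero => simpa using hlow
    | succ d ih =>
      intro μ hμ
      rcases lt_or_ge μ (b + d) with h1 | h1
      · exact ih μ h1
      obtain rfl : μ = b + d := by push_cast at hμ; omega
      rcases lt_or_ge t (b + d) with h2 | h2
      · exact hhigh _ h2
      -- With this j the weight `bin (t - μ) j` is 1 at μ = b + d and 0 for b + d < μ ≤ t. Smaller μ
      -- are settled by induction and larger ones by truncation, so `key` isolates the entry at b +
      -- d.
      obtain ⟨j, hj⟩ : ∃ j : ℕ, t - (b + d) = j := ⟨(t - (b + d)).toNat, by omega⟩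
      have h3 := key s t j
      rw [← sub_eq_zero, ← finsum_sub_distrib (IsLaurent₂.hasFiniteSupport ⟨N, hN⟩ _ _)
        (IsLaurent₂.hasFiniteSupport ⟨N', hN'⟩ _ _), finsum_eq_single _ (b + (d : ℤ))] at h3
      · rw [hj, bin_nat, Ring.choose_natCast, Nat.choose_self, Nat.cast_one, one_smul, one_smul,
          sub_eq_zero] at h3
        exact h3
      · intro ν hν
        rcases lt_or_gt_of_ne hν with h4 | h4
        · rw [ih ν h4, sub_self]
        · rcases lt_or_ge t ν with h5 | h5
          · rw [hhigh ν h5, sub_self]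
          · rw [bin_nat, choose_nat_of_lt (by omega) (by omega), zero_smul, zero_smul, sub_self]
  intro μ
  rcases lt_or_ge μ b with h1 | h1
  · exact hlow μ h1
  · exact hind ((μ - b).toNat + 1) μ (by push_cast; omega)

/-- One side of the equality bounds the powers of x₂ below, the other those of x₁. -/
theorem isLaurent₂_of_expand_eq {α β : ℤ → ℤ → M} {N : ℤ} (hα : ∀ m n, n < N → α m n = 0)
    (hβ : ∀ m n, m < N → β m n = 0) {k : ℕ} (h : expand k α = expand k β) :
    IsLaurent₂ (expand k α) := by
  refine ⟨N - k, fun m n hmn => ?_⟩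
  rcases hmn with hm | hn
  · rw [h, expand_nat]
    exact Finset.sum_eq_zero fun i _ => by rw [hβ _ _ (by omega), smul_zero]
  · rw [expand_nat]
    refine Finset.sum_eq_zero fun i hi => ?_
    rw [Finset.mem_range] at hi
    rw [hα _ _ (by omega), smul_zero]

/-- The difference of the two expansions of `(y₁ - y₂)^l` paired with mutually local fields. -/
theorem expand_sub_expand_swap {α β : ℤ → ℤ → M} {N : ℤ} (hα : ∀ m n, n < N → α m n = 0)
    (hβ : ∀ m n, m < N → β m n = 0) {k : ℕ} (h : expand k α = expand k β) (l m n : ℤ) :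
    expand l β m n - (l.negOnePow : ℤ) • expand l (swap α) n m
      = ∑ᶠ μ : ℤ, bin (m - 1 - μ) (k - 1 - l) • expand k α μ (m + n - 1 - (k - 1 - l) - μ) := by
  have hA := isLaurent₂_of_expand_eq hα hβ h
  set A := expand k α with hAdef
  obtain ⟨N', hN'⟩ := hA
  obtain ⟨d, rfl⟩ : ∃ d, l = d + k := ⟨l - k, by ring⟩
  have e1 : expand (d + k) β = expand d A := by rw [← expand_expand d k hβ, ← h]
  have e2 : expand (d + k) (swap α) n m = ((-1) ^ k : ℤ) • expand d (swap A) n m := by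
    rw [← expand_expand d k (N := N) (β := swap α) fun m n hm => hα n m hm]
    have : expand k (swap α) = fun n m => ((-1) ^ k : ℤ) • swap A n m := by
      funext n m
      exact expand_nat_swap k α m n
    rw [this, expand_zsmul d _ (N := N') (β := swap A) fun n m hn => hN' m n (Or.inr hn)]
  have e3 : ((d + k).negOnePow : ℤ) * (-1) ^ k = d.negOnePow := by
    rw [Int.negOnePow_add, Units.val_mul, Int.coe_negOnePow_natCast, mul_assoc, ← pow_add,
      Even.neg_one_pow ⟨k, rfl⟩, mul_one]
  rw [e1, e2, smul_smul, e3]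
  -- Both expansions now act on the same Laurent series A. For d ≥ 0 they coincide. For d = −1 − j
  -- they differ by a j-th derivative of a delta function: the indices μ < m come from the first
  -- expansion and μ ≥ m from the second.
  rcases lt_or_ge d 0 with hd | hd
  · obtain ⟨j, rfl⟩ : ∃ j : ℕ, d = -1 - j := ⟨(-1 - d).toNat, by omega⟩
    rw [show (k : ℤ) - 1 - (-1 - j + k) = j by ring]
    rw [finsum_int_split (IsLaurent₂.hasFiniteSupport ⟨N', hN'⟩ _ _) m, sub_eq_add_neg]
    congr 1
    · rw [← finsum_shift (N := j) fun i hi => by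
        rw [bin_nat, choose_nat_of_lt (by omega) (by omega), zero_smul], expand]
      refine finsum_congr fun i => ?_
      rw [bin_nat, show (-1 - (j : ℤ)) = -(j + 1 : ℤ) by ring, choose_neg_eq, ← mul_assoc,
        ← pow_add, Even.neg_one_pow ⟨i, rfl⟩, one_mul]
      have : Ring.choose ((j : ℤ) + 1 + i - 1) i
          = Ring.choose (m - 1 - (m - 1 - ((j + i : ℕ) : ℤ))) j := by
        rw [show (j : ℤ) + 1 + i - 1 = ((j + i : ℕ) : ℤ) by push_cast; ring,
          show (m - 1 - (m - 1 - ((j + i : ℕ) : ℤ))) = ((j + i : ℕ) : ℤ) by ring,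
          Ring.choose_natCast, Ring.choose_natCast, Nat.choose_symm_add]
      rw [this]
      push_cast
      congr 2 <;> ring
    · rw [expand, ← neg_smul, zsmul_finsum _ (hasFiniteSupport_of_le
        (N := (n + (-1 - j) - N' + 1).toNat) fun i hi => by
          rw [swap, hN' _ _ (by omega), smul_zero])]
      refine finsum_congr fun i => ?_
      rw [smul_smul, bin_nat, show (-1 - (j : ℤ)) = -(j + 1 : ℤ) by ring, choose_neg_eq,
        ← mul_assoc ((-1) ^ i : ℤ), ← pow_add, Even.neg_one_pow ⟨i, rfl⟩, one_mul,
        show m - 1 - (m + i) = -(i + 1 : ℤ) by ring, choose_neg_eq, Int.negOnePow_neg,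
        Int.negOnePow_succ, Units.val_neg, Int.coe_negOnePow_natCast, neg_neg,
        show (j : ℤ) + 1 + i - 1 = ((i + j : ℕ) : ℤ) by push_cast; ring,
        show (i : ℤ) + 1 + j - 1 = ((i + j : ℕ) : ℤ) by push_cast; ring,
        Ring.choose_natCast, Ring.choose_natCast, Nat.choose_symm_add, swap]
      congr 2; ring
  · lift d to ℕ using hd
    rw [expand_nat_swap, smul_smul, Int.coe_negOnePow_natCast, ← pow_add, Even.neg_one_pow ⟨d, rfl⟩,
      one_smul, sub_self, finsum_eq_zero_of_forall fun μ => ?_]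
    rw [bin_neg _ (by omega), zero_smul]

end Expand

end VertexOp

namespace VertexOp

/-! ### The series `φ(x, z) = x / (1 + zx)` -/

section Phi

open PowerSeries

/-- `(1 + zx)^r`. -/
noncomputable def onePlusPow (r : ℤ) : PowerSeries (LaurentSeries ℂ) :=
  mk fun l => HahnSeries.single (l : ℤ) ((Ring.choose r l : ℤ) : ℂ)

theorem coeff_onePlusPow (r : ℤ) (l : ℕ) :
    coeff l (onePlusPow r) = HahnSeries.single (l : ℤ) ((Ring.choose r l : ℤ) : ℂ) :=
  coeff_mk _ _

theorem onePlusPow_add (r s : ℤ) : onePlusPow (r + s) = onePlusPow r * onePlusPow s := by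
  ext1 l
  rw [coeff_mul, coeff_onePlusPow, choose_add, Int.cast_sum]
  refine (map_sum (HahnSeries.single.addMonoidHom (l : ℤ)) _ _).trans ?_
  refine Finset.sum_congr rfl fun ij hij => ?_
  rw [Finset.HasAntidiagonal.mem_antidiagonal] at hij
  rw [coeff_onePlusPow, coeff_onePlusPow, HahnSeries.single_mul_single, ← hij]
  push_cast
  rfl

theorem onePlusPow_zero : onePlusPow 0 = 1 := by
  ext1 l
  rw [coeff_onePlusPow, coeff_one, Ring.choose_zero_ite]
  split_ifs with h
  · subst h; simp
  · simp

theorem onePlusPow_one : onePlusPow 1 = 1 + X * C xVar := by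
  ext1 l
  rw [coeff_onePlusPow, map_add, coeff_one, coeff_mul_C, coeff_X]
  rcases l with _ | _ | l
  · simp
  · simp [xVar]
  · rw [choose_nat_of_lt (by norm_num) (by push_cast; omega)]
    simp

theorem xVar_pow (n : ℕ) : xVar ^ n = HahnSeries.single (n : ℤ) (1 : ℂ) := by
  rw [xVar, HahnSeries.single_pow]; simp

theorem xVar_ne_zero : xVar ≠ 0 := by
  rw [xVar]; exact HahnSeries.single_ne_zero one_ne_zero

theorem xVar_zpow (n : ℤ) : xVar ^ n = HahnSeries.single n (1 : ℂ) := by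
  obtain ⟨k, rfl | rfl⟩ := n.eq_nat_or_neg
  · rw [zpow_natCast, xVar_pow]
  · rw [zpow_neg, zpow_natCast, xVar_pow, HahnSeries.inv_single, inv_one]

theorem phi_eq : phi = C xVar * onePlusPow (-1) := by
  have h : onePlusPow (-1) * onePlusPow 1 = 1 := by
    rw [← onePlusPow_add]; exact onePlusPow_zero
  have hc : constantCoeff (onePlusPow 1) ≠ 0 := by
    rw [onePlusPow_one]; simp
  rw [phi, ← onePlusPow_one, (PowerSeries.eq_inv_iff_mul_eq_one hc).2 h]

/-- `φ^m = x^m (1 + zx)^(-m)`. -/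
theorem zpowSeries_phi (m : ℤ) : zpowSeries phi m = C (xVar ^ m) * onePlusPow (-m) := by
  have hpow : ∀ (r : ℤ) (n : ℕ), onePlusPow r ^ n = onePlusPow (n * r) := by
    intro r n
    induction n with
    | zero => rw [pow_zero, Nat.cast_zero, zero_mul, onePlusPow_zero]
    | succ n ih =>
      rw [pow_succ, ih, ← onePlusPow_add]; congr 1; push_cast; ring
  have hinv : phi⁻¹ = C (xVar⁻¹) * onePlusPow 1 := by
    have hc : constantCoeff phi ≠ 0 := by
      rw [phi_eq, map_mul, constantCoeff_C]
      refine mul_ne_zero xVar_ne_zero ?_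
      rw [← coeff_zero_eq_constantCoeff_apply, coeff_onePlusPow]
      simp
    symm
    rw [PowerSeries.eq_inv_iff_mul_eq_one hc, phi_eq, mul_mul_mul_comm, ← map_mul,
      inv_mul_cancel₀ xVar_ne_zero, ← onePlusPow_add, map_one, one_mul]
    exact onePlusPow_zero
  cases m with
  | ofNat n =>
    change phi ^ n = _
    rw [phi_eq, mul_pow, hpow, ← map_pow]
    congr 2
    simp
  | negSucc n =>
    change phi⁻¹ ^ (n + 1) = _
    rw [hinv, mul_pow, hpow, ← map_pow, Int.negSucc_eq, zpow_neg, inv_pow, neg_neg, mul_one]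
    congr 2

theorem coeff_zpowSeries_phi (m : ℤ) (l : ℕ) :
    coeff l (zpowSeries phi m) = HahnSeries.single (m + l) ((Ring.choose (-m) l : ℤ) : ℂ) := by
  rw [zpowSeries_phi, coeff_C_mul, coeff_onePlusPow, xVar_zpow, HahnSeries.single_mul_single,
    one_mul]

/-- From φ·(1 + zx) = x one gets φ − x = −zxφ, and φ^k = x^k (1 + zx)^(−k). -/
theorem phi_sub_pow (k : ℕ) : (phi - C xVar) ^ k
    = X ^ k * (C ((-1) ^ k * xVar ^ (2 * k)) * onePlusPow (-k)) := by
  have h : phi - C xVar = X * (C (-1 * xVar ) * phi) := by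
    have h1 : phi * onePlusPow 1 = C xVar := by
      rw [phi_eq, mul_assoc, ← onePlusPow_add]
      exact (congrArg _ onePlusPow_zero).trans (mul_one _)
    rw [onePlusPow_one] at h1
    rw [map_mul, map_neg, map_one]
    linear_combination h1
  have h2 : phi ^ k = C (xVar ^ k) * onePlusPow (-k) := by
    have := zpowSeries_phi k
    rwa [zpow_natCast] at this
  rw [h, mul_pow, mul_pow, h2, ← map_pow, ← mul_assoc (C _), ← map_mul]
  congr 3
  ring

theorem coeff_phi_sub_pow_add (k i : ℕ) : coeff (k + i) ((phi - C xVar) ^ k)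
    = HahnSeries.single (2 * k + i : ℤ) ((-1 : ℂ) ^ k * ((Ring.choose (-k : ℤ) i : ℤ) : ℂ)) := by
  rw [phi_sub_pow, add_comm k i, coeff_X_pow_mul, coeff_C_mul, coeff_onePlusPow, xVar_pow,
    mul_assoc, HahnSeries.single_mul_single, one_mul]
  have : ((-1 : LaurentSeries ℂ)) ^ k = HahnSeries.single 0 ((-1 : ℂ) ^ k) := by
    rw [← HahnSeries.C_apply, map_pow, map_neg, map_one]
  rw [this, HahnSeries.single_mul_single, zero_add]
  push_cast
  rfl

theorem coeff_phi_sub_pow_of_lt {k n : ℕ} (h : n < k) : coeff n ((phi - C xVar) ^ k) = 0 := by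
  rw [phi_sub_pow, coeff_X_pow_mul', if_neg (by omega)]

end Phi

end VertexOp

namespace VertexOp

/-! ### Associativity in the variable `y = x⁻¹` -/

section Assoc

variable {V : Type u} [AddCommGroup V] [Module ℂ V] {W : Type v} [AddCommGroup W] [Module ℂ W]

theorem exists_coeff_eq_zero (F : VertexOperator ℂ W) (w : W) :
    ∃ N : ℤ, ∀ n < N, HVertexOperator.coeff F n w = 0 :=
  ⟨_, fun n hn => VertexOperator.coeff_eq_zero_of_lt_order F n w hn⟩

/-- The coefficients of `Y_W(a, x₁) Y_W(b, x₂) w`. -/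
def prodCoeff (YW : V →ₗ[ℂ] VertexOperator ℂ W) (a b : V) (w : W) : ℤ → ℤ → W := fun m n =>
  HVertexOperator.coeff (YW a) m (HVertexOperator.coeff (YW b) n w)

theorem exists_prodCoeff_eq_zero (YW : V →ₗ[ℂ] VertexOperator ℂ W) (a b : V) (w : W) :
    ∃ N : ℤ, ∀ m n, n < N → prodCoeff YW a b w m n = 0 := by
  obtain ⟨N, hN⟩ := exists_coeff_eq_zero (YW b) w
  exact ⟨N, fun m n hn => by rw [prodCoeff, hN n hn, map_zero]⟩

theorem zsmul_eq_cast_smul (c : ℤ) (w : W) : (c : ℂ) • w = c • w := Int.cast_smul_eq_zsmul ℂ c w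

/-- This is x₁ − x₂ = −x₁x₂(y₁ − y₂), raised to the power k. -/
theorem locProd_eq (YW : V →ₗ[ℂ] VertexOperator ℂ W) (k : ℕ) (a b : V) (w : W) (m n : ℤ) :
    locProd YW k a b w m n = ((-1) ^ k : ℤ) • expand k (prodCoeff YW a b w) (m - k) (n - k) := by
  rw [← expand_nat_swap, expand_nat, locProd]
  refine Finset.sum_congr rfl fun i _ => ?_
  rw [← zsmul_eq_cast_smul, swap, prodCoeff]
  push_cast
  rw [show m - (k - i : ℤ) = m - k + i by ring, show n - (i : ℤ) = n - k + k - i by ring]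

/-- Associativity of `Y_W` for the pair `(a, b)` and `y₁ = y₂ + z`, where `y = x⁻¹`. -/
structure IsInvAssoc (Y : V →ₗ[ℂ] VertexOperator ℂ V) (YW : V →ₗ[ℂ] VertexOperator ℂ W) (k : ℕ)
    (a b : V) : Prop where
  laurent : ∀ w, IsLaurent₂ (expand k (prodCoeff YW a b w))
  moment_eq : ∀ w l p, moment (expand k (prodCoeff YW a b w)) l p
    = HVertexOperator.coeff (YW (HVertexOperator.coeff (Y a) (l - k) b)) p w

theorem isLaurent₂_locProd_iff (YW : V →ₗ[ℂ] VertexOperator ℂ W) (k : ℕ) (a b : V) (w : W) :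
    IsLaurent₂ (locProd YW k a b w) ↔ IsLaurent₂ (expand k (prodCoeff YW a b w)) := by
  constructor
  · rintro ⟨N, hN⟩
    refine ⟨N - k, fun m n hmn => ?_⟩
    have h := hN (m + k) (n + k) (by omega)
    rw [locProd_eq, add_sub_cancel_right, add_sub_cancel_right] at h
    have h2 := congrArg (fun x => ((-1) ^ k : ℤ) • x) h
    simpa [smul_smul, ← mul_pow] using h2
  · rintro ⟨N, hN⟩
    refine ⟨N + k, fun m n hmn => ?_⟩
    rw [locProd_eq, hN _ _ (by omega), smul_zero]

/-- The prefactor (x₁x₂)^k of `locProd_eq` turns into φ^k x^k = x^{2k}(1 + zx)^{−k}, which supplies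
the weights and the shift by 2k + i. -/
theorem substCoeff_locProd {YW : V →ₗ[ℂ] VertexOperator ℂ W} {k : ℕ} {a b : V} {w : W}
    (h : IsLaurent₂ (expand k (prodCoeff YW a b w))) (l p : ℤ) :
    substCoeff phi (locProd YW k a b w) l p = ((-1) ^ k : ℤ) • ∑ᶠ i : ℕ, Ring.choose (-k : ℤ) i •
      moment (expand k (prodCoeff YW a b w)) (l - i) (p - 2 * k - i) := by
  have h1 := finsum_bin_add h (-k) l (p - l - 2 * k)
  have h2 : ∀ i : ℕ, p - l - 2 * k + l - i = p - 2 * k - i := fun i => by ring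
  simp only [h2] at h1
  rw [← h1, substCoeff]
  split_ifs with hl
  · lift l to ℕ using hl
    rw [zsmul_finsum _ (h.hasFiniteSupport _ _)]
    -- Each z-coefficient of φ^m is a single monomial in x, so the double sum lives on one line.
    let e : ℤ → ℤ × ℤ := fun μ => (μ + k, p - l - (μ + k))
    have he : Function.Injective e := fun μ ν h => by
      have := congrArg Prod.fst h
      simpa [e] using this
    rw [← finsum_comp_of_injective he]
    · refine finsum_congr fun μ => ?_
      simp only [e]
      rw [Int.toNat_natCast, coeff_zpowSeries_phi,
        show p - (p - l - (μ + k)) = μ + k + l by ring, HahnSeries.coeff_single_same, locProd_eq,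
        zsmul_eq_cast_smul, smul_comm, bin_nat]
      congr 3 <;> ring_nf
    · rintro ⟨m, n⟩ hmn
      refine ⟨m - k, ?_⟩
      by_contra hc
      refine hmn ?_
      dsimp only
      rw [Int.toNat_natCast, coeff_zpowSeries_phi, HahnSeries.coeff_single_of_ne, zero_smul]
      intro h3
      refine hc ?_
      simp only [e, Prod.mk.injEq]
      omega
  · rw [finsum_eq_zero_of_forall fun μ => by rw [bin_neg _ (by omega), zero_smul], smul_zero]

/-- By `phi_sub_pow` the same factor (−1)^k x^{2k}(1 + zx)^{−k} appears as in `substCoeff_locProd`,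
together with z^k. -/
theorem iterCoeff_phi_sub_pow (Y : V →ₗ[ℂ] VertexOperator ℂ V) (YW : V →ₗ[ℂ] VertexOperator ℂ W)
    (k : ℕ) (a b : V) (w : W) (l p : ℤ) :
    iterCoeff Y YW ((phi - PowerSeries.C xVar) ^ k) a b w l p
      = ((-1) ^ k : ℤ) • ∑ᶠ i : ℕ, Ring.choose (-k : ℤ) i •
        HVertexOperator.coeff (YW (HVertexOperator.coeff (Y a) (l - i - k) b)) (p - 2 * k - i) w := by
  obtain ⟨N, hN⟩ := exists_coeff_eq_zero (Y a) b
  rw [zsmul_finsum _ (hasFiniteSupport_of_le (N := (l - k - N + 1).toNat) fun i hi => by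
    rw [hN _ (by omega), map_zero, map_zero, Pi.zero_apply, LinearMap.zero_apply, smul_zero]),
    iterCoeff]
  let e : ℕ → ℕ × ℤ := fun i => (k + i, 2 * k + i)
  have he : Function.Injective e := fun i j h => by
    have := congrArg Prod.fst h
    simpa [e] using this
  rw [← finsum_comp_of_injective he]
  · refine finsum_congr fun i => ?_
    simp only [e]
    rw [coeff_phi_sub_pow_add, HahnSeries.coeff_single_same, mul_smul, zsmul_eq_cast_smul,
      show l - ((k + i : ℕ) : ℤ) = l - i - k by push_cast; ring,
      show p - (2 * k + i : ℤ) = p - 2 * k - i by ring, ← zsmul_eq_cast_smul ((-1) ^ k)]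
    push_cast
    rfl
  · rintro ⟨n, q⟩ hnq
    by_contra hc
    refine hnq ?_
    dsimp only
    rcases lt_or_ge n k with h | h
    · rw [coeff_phi_sub_pow_of_lt h, HahnSeries.coeff_zero, zero_smul]
    · obtain ⟨i, rfl⟩ := Nat.exists_eq_add_of_le h
      rw [coeff_phi_sub_pow_add, HahnSeries.coeff_single_of_ne, zero_smul]
      rintro rfl
      exact hc ⟨i, rfl⟩

/-- A unitriangular system has at most one solution. -/
theorem eq_of_finsum_eq {M : Type*} [AddCommGroup M] {F G : ℤ → ℤ → M} {N : ℤ} (hF : ∀ l p, l < N → F l p = 0)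
    (hG : ∀ l p, l < N → G l p = 0) (c : ℕ → ℤ) (hc : c 0 = 1)
    (h : ∀ l p, ∑ᶠ i : ℕ, c i • F (l - i) (p - i) = ∑ᶠ i : ℕ, c i • G (l - i) (p - i)) (l p : ℤ) :
    F l p = G l p := by
  have key : ∀ d : ℕ, ∀ l < N + d, ∀ p, F l p = G l p := by
    intro d
    induction d with
    | zero => intro l hl p; rw [hF _ _ (by simpa using hl), hG _ _ (by simpa using hl)]
    | succ d ih =>
      intro l hl p
      have h1 := h l p
      have fin : ∀ H : ℤ → ℤ → M, (∀ l p, l < N → H l p = 0) →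
          (fun i : ℕ => c i • H (l - i) (p - i)).HasFiniteSupport := fun H hH =>
        hasFiniteSupport_of_le (N := (l - N + 1).toNat) fun i hi => by
          rw [hH _ _ (by omega), smul_zero]
      rw [← sub_eq_zero, ← finsum_sub_distrib (fin F hF) (fin G hG),
        finsum_eq_single _ 0 fun i hi => by
          rw [ih _ (by push_cast at hl; omega), sub_self]] at h1
      simpa [hc, sub_eq_zero] using h1
  exact key ((l - N).toNat + 1) l (by push_cast; omega) p

/-- Both sides of φ-associativity carry the factor (−1)^k x^{2k}(1 + zx)^{−k}. It is a unit and
cancels by `eq_of_finsum_eq`, leaving associativity in y with the same k. -/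
theorem isPhiModule_iff (A : VertexAlgebra V) (YW : V →ₗ[ℂ] VertexOperator ℂ W) :
    IsPhiModule phi A YW ↔ IsVacuum A.one YW ∧ ∀ a b, ∃ k, IsInvAssoc A.Y YW k a b := by
  refine ⟨fun h => ⟨h.vacuum, fun a b => ?_⟩, fun h => ⟨h.1, fun a b => ?_⟩⟩
  · obtain ⟨k, h1, h2⟩ := h.assoc a b
    have h1' := fun w => (isLaurent₂_locProd_iff YW k a b w).1 (h1 w)
    refine ⟨k, h1', fun w l p => ?_⟩
    obtain ⟨N, hN⟩ := exists_coeff_eq_zero (A.Y a) b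
    have h3 := eq_of_finsum_eq (N := min 0 (N + k))
      (F := fun l p => moment (expand k (prodCoeff YW a b w)) l p)
      (G := fun l p => HVertexOperator.coeff (YW (HVertexOperator.coeff (A.Y a) (l - k) b)) p w)
      (fun l p hl => moment_eq_zero_of_neg _ (by omega) _)
      (fun l p hl => by
        rw [hN _ (by omega), map_zero, map_zero, Pi.zero_apply, LinearMap.zero_apply])
      (fun i => Ring.choose (-k : ℤ) i) (by simp) (fun l p => ?_) l p
    · exact h3
    · have h4 := h2 w l (p + 2 * k)
      rw [substCoeff_locProd (h1' w), iterCoeff_phi_sub_pow] at h4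
      have h5 := congrArg (fun x => ((-1) ^ k : ℤ) • x) h4
      simpa [smul_smul, ← mul_pow] using h5
  · obtain ⟨k, h1, h2⟩ := h.2 a b
    refine ⟨k, fun w => (isLaurent₂_locProd_iff YW k a b w).2 (h1 w), fun w l p => ?_⟩
    rw [substCoeff_locProd (h1 w), iterCoeff_phi_sub_pow]
    simp only [h2]

end Assoc

end VertexOp

/-! ### Associativity, locality and the Jacobi identity with reversed operators. -/

namespace VertexOp

section Jacobi

variable {V : Type u} [AddCommGroup V] [Module ℂ V] {W : Type v} [AddCommGroup W] [Module ℂ W]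

/-- The Jacobi identity for `Y_W(·, y⁻¹)` with the order of the operators reversed. -/
def InvJacobi (Y : V →ₗ[ℂ] VertexOperator ℂ V) (YW : V →ₗ[ℂ] VertexOperator ℂ W) (a b : V) : Prop :=
  ∀ (w : W) (l m n : ℤ), expand l (swap (prodCoeff YW b a w)) m n
      - (l.negOnePow : ℤ) • expand l (swap (prodCoeff YW a b w)) n m
    = ∑ᶠ i : ℕ, Ring.choose (m - 1) i •
      HVertexOperator.coeff (YW (VertexOperator.ncoeff (Y a) (l + i) b)) (m + n - 1 - i) w

/-- `(y₁ - y₂)^k [Y_W(a, x₁), Y_W(b, x₂)] = 0`, where `y = x⁻¹`. -/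
def IsLocal (YW : V →ₗ[ℂ] VertexOperator ℂ W) (k : ℕ) (a b : V) : Prop :=
  ∀ w, expand k (prodCoeff YW a b w) = expand k (swap (prodCoeff YW b a w))

theorem IsLocal.exists_bound {YW : V →ₗ[ℂ] VertexOperator ℂ W} {a b : V} (w : W) :
    ∃ N, (∀ m n, n < N → prodCoeff YW a b w m n = 0)
      ∧ ∀ m n, m < N → swap (prodCoeff YW b a w) m n = 0 := by
  obtain ⟨N₁, h₁⟩ := exists_prodCoeff_eq_zero YW a b w
  obtain ⟨N₂, h₂⟩ := exists_prodCoeff_eq_zero YW b a w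
  exact ⟨min N₁ N₂, fun m n hn => h₁ m n (by omega), fun m n hm => h₂ n m (by omega)⟩

theorem IsLocal.laurent {YW : V →ₗ[ℂ] VertexOperator ℂ W} {k : ℕ} {a b : V}
    (h : IsLocal YW k a b) (w : W) : IsLaurent₂ (expand k (prodCoeff YW a b w)) := by
  obtain ⟨N, h₁, h₂⟩ := IsLocal.exists_bound (YW := YW) (a := a) (b := b) w
  exact isLaurent₂_of_expand_eq h₁ h₂ (h w)

theorem IsLocal.expand_sub {YW : V →ₗ[ℂ] VertexOperator ℂ W} {k : ℕ} {a b : V}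
    (h : IsLocal YW k a b) (w : W) (l m n : ℤ) : expand l (swap (prodCoeff YW b a w)) m n
      - (l.negOnePow : ℤ) • expand l (swap (prodCoeff YW a b w)) n m
    = ∑ᶠ i : ℕ, Ring.choose (m - 1) i •
      moment (expand k (prodCoeff YW a b w)) (k - 1 - l - i) (m + n - 1 - i) := by
  obtain ⟨N, h₁, h₂⟩ := IsLocal.exists_bound (YW := YW) (a := a) (b := b) w
  rw [expand_sub_expand_swap h₁ h₂ (h w), finsum_bin_add (h.laurent w)]
  simp only [sub_add_cancel]

/-- By `IsLocal.expand_sub`, locality alone gives the left side of `InvJacobi` the shape of its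
right side, with moments in place of iterates. Associativity matches them term by term. -/
theorem IsLocal.isInvAssoc_iff (Y : V →ₗ[ℂ] VertexOperator ℂ V) {YW : V →ₗ[ℂ] VertexOperator ℂ W}
    {k : ℕ} {a b : V} (h : IsLocal YW k a b) : IsInvAssoc Y YW k a b ↔ InvJacobi Y YW a b := by
  constructor
  · intro hA w l m n
    rw [h.expand_sub]
    refine finsum_congr fun i => ?_
    rw [hA.moment_eq, VertexOperator.ncoeff_apply]
    congr 5
    ring_nf
  · refine fun hJ => ⟨h.laurent, fun w l p => ?_⟩
    -- With m = 1 the weights `Ring.choose (m - 1) i` vanish for i > 0, which isolates a single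
    -- moment.
    have h1 := hJ w (k - 1 - l) 1 p
    rw [h.expand_sub, finsum_eq_single _ 0 fun i hi => by
        rw [sub_self, Ring.choose_zero_pos _ (Nat.pos_of_ne_zero hi), zero_smul],
      finsum_eq_single _ 0 fun i hi => by
        rw [sub_self, Ring.choose_zero_pos _ (Nat.pos_of_ne_zero hi), zero_smul]] at h1
    simp only [Ring.choose_zero_right, one_smul, Nat.cast_zero, sub_zero, add_zero,
      sub_sub_cancel, add_sub_cancel_left, VertexOperator.ncoeff_apply] at h1
    rw [h1]
    congr 5
    ring_nf

/-- Choose l ≥ 0 so large that a_{l+i} b = 0 for all i: the right side disappears and the left side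
is the commutator multiplied by (y₁ − y₂)^l. -/
theorem InvJacobi.exists_isLocal {Y : V →ₗ[ℂ] VertexOperator ℂ V}
    {YW : V →ₗ[ℂ] VertexOperator ℂ W} {a b : V} (h : InvJacobi Y YW a b) :
    ∃ k, IsLocal YW k a b := by
  obtain ⟨N, hN⟩ := exists_coeff_eq_zero (Y a) b
  refine ⟨(-N).toNat, fun w => ?_⟩
  funext m n
  have h1 := h w ((-N).toNat : ℤ) m n
  rw [finsum_eq_zero_of_forall fun i => by
      rw [VertexOperator.ncoeff_apply, hN _ (by omega), map_zero, map_zero, Pi.zero_apply,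
        LinearMap.zero_apply, smul_zero],
    expand_nat_swap _ (prodCoeff YW a b w), smul_smul, Int.coe_negOnePow_natCast, ← pow_add,
    Even.neg_one_pow ⟨_, rfl⟩, one_smul, sub_eq_zero] at h1
  exact h1.symm

/-- Raising k multiplies both sides by z = y₁ − y₂. This is reversible as long as the product is
already Laurent for the smaller exponent. -/
theorem isInvAssoc_succ_iff {Y : V →ₗ[ℂ] VertexOperator ℂ V} {YW : V →ₗ[ℂ] VertexOperator ℂ W}
    {k : ℕ} {a b : V} (h : ∀ w, IsLaurent₂ (expand k (prodCoeff YW a b w))) :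
    IsInvAssoc Y YW (k + 1) a b ↔ IsInvAssoc Y YW k a b := by
  constructor
  · refine fun hA => ⟨h, fun w l p => ?_⟩
    have h1 := hA.moment_eq w (l + 1) p
    rw [moment_expand_succ (h w), add_sub_cancel_right] at h1
    rw [h1]
    push_cast
    congr 5
    ring_nf
  · refine fun hA => ⟨fun w => (h w).expand_succ, fun w l p => ?_⟩
    rw [moment_expand_succ (h w), hA.moment_eq]
    push_cast
    congr 5
    ring_nf

theorem IsInvAssoc.mono {Y : V →ₗ[ℂ] VertexOperator ℂ V} {YW : V →ₗ[ℂ] VertexOperator ℂ W}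
    {k k' : ℕ} {a b : V} (h : IsInvAssoc Y YW k a b) (hk : k ≤ k') : IsInvAssoc Y YW k' a b := by
  induction k', hk using Nat.le_induction with
  | base => exact h
  | succ n _ ih => exact (isInvAssoc_succ_iff ih.laurent).2 ih

theorem IsInvAssoc.of_laurent {Y : V →ₗ[ℂ] VertexOperator ℂ V} {YW : V →ₗ[ℂ] VertexOperator ℂ W}
    {k : ℕ} {a b : V} (h : IsInvAssoc Y YW k a b)
    (h0 : ∀ w, IsLaurent₂ (expand 0 (prodCoeff YW a b w))) : IsInvAssoc Y YW 0 a b := by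
  have hl : ∀ n : ℕ, ∀ w, IsLaurent₂ (expand n (prodCoeff YW a b w)) := by
    intro n
    induction n with
    | zero => exact h0
    | succ n ih => exact fun w => (ih w).expand_succ
  induction k with
  | zero => exact h
  | succ n ih => exact ih ((isInvAssoc_succ_iff (hl n)).1 h)

theorem expand_zero {M : Type*} [AddCommGroup M] (β : ℤ → ℤ → M) : expand 0 β = β := by
  funext m n
  have := expand_nat 0 β m n
  simpa using this

/-- `Y_W(e^{zD} a, x) = Y_W(a, φ(x, z))`, where `e^{zD} a = Y(a, z)1`. -/
theorem coeff_translate (A : VertexAlgebra V) {YW : V →ₗ[ℂ] VertexOperator ℂ W}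
    (h0 : IsVacuum A.one YW) {k : ℕ} {a : V} (h : IsInvAssoc A.Y YW k a A.one) (w : W) (l : ℕ)
    (p : ℤ) : HVertexOperator.coeff (YW (HVertexOperator.coeff (A.Y a) l A.one)) p w
      = Ring.choose (l - p) l • HVertexOperator.coeff (YW a) (p - l) w := by
  have h1 : ∀ w m n, expand 0 (prodCoeff YW a A.one w) m n
      = if n = 0 then HVertexOperator.coeff (YW a) m w else 0 := by
    intro w m n
    rw [expand_zero, prodCoeff, h0]
    split_ifs <;> simp
  -- Against the vacuum the product is Y_W(a, x₁)w, already Laurent, so k can be lowered to 0.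
  have h2 : IsInvAssoc A.Y YW 0 a A.one := by
    refine h.of_laurent fun w => ?_
    obtain ⟨N, hN⟩ := exists_coeff_eq_zero (YW a) w
    refine ⟨min N 0, fun m n hmn => ?_⟩
    rw [h1]
    split_ifs with hn
    · exact hN _ (by omega)
    · rfl
  have h3 := h2.moment_eq w l p
  rw [Nat.cast_zero, sub_zero] at h3
  rw [← h3, moment, finsum_eq_single _ (p - l) fun μ hμ => by
    rw [h1, if_neg (by omega), smul_zero], h1, if_pos (by ring), bin_nat, neg_sub]

theorem cast_negOnePow (l : ℤ) : ((l.negOnePow : ℤ) : ℂ) = (-1 : ℂ) ^ l := by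
  rcases Int.even_or_odd l with h | h
  · rw [Int.negOnePow_even l h, h.neg_one_zpow]; simp
  · rw [Int.negOnePow_odd l h, h.neg_one_zpow]; simp

/-- Skew symmetry: `Y(a, x)b = e^{xD} Y(b, -x)a`. -/
theorem VertexAlgebra.skew (A : VertexAlgebra V) (a b : V) (l : ℤ) :
    VertexOperator.ncoeff (A.Y a) l b = -(l.negOnePow : ℤ) • ∑ᶠ i : ℕ, ((-1) ^ i : ℤ) •
      HVertexOperator.coeff (A.Y (VertexOperator.ncoeff (A.Y b) (l + i) a)) i A.one := by
  -- On the vacuum with n = 0 the first sum dies, as a_i 1 = 0 for i ≥ 0; with m = −1 the second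
  -- keeps only b_{−1}1 = b.
  have h := A.jacobi b a A.one l (-1) 0
  have hz : ∀ (c : V) (n : ℤ), 0 ≤ n → VertexOperator.ncoeff (A.Y c) n A.one = 0 := fun c n hn =>
    A.creation_regular c _ (by omega)
  rw [finsum_eq_zero_of_forall fun i => by rw [hz _ _ (by omega), map_zero, smul_zero],
    finsum_eq_single _ 0 fun i hi => by rw [hz _ _ (by omega), map_zero, smul_zero]] at h
  have h1 : VertexOperator.ncoeff (A.Y b) (-1 + (0 : ℕ)) A.one = b := A.creation_limit b
  rw [h1, zero_sub] at h
  have h2 : ∀ i : ℕ, ((Ring.choose (-1 : ℤ) i : ℤ) : ℂ) •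
      VertexOperator.ncoeff (A.Y (VertexOperator.ncoeff (A.Y b) (l + i) a)) (-1 + 0 - i) A.one
      = ((-1) ^ i : ℤ) •
        HVertexOperator.coeff (A.Y (VertexOperator.ncoeff (A.Y b) (l + i) a)) i A.one := by
    intro i
    rw [zsmul_eq_cast_smul, choose_neg_eq, VertexOperator.ncoeff_apply,
      show (1 : ℤ) + i - 1 = (i : ℕ) by ring, Ring.choose_natCast, Nat.choose_self, Nat.cast_one,
      mul_one, show -(-1 + 0 - (i : ℤ)) - 1 = i by ring]
  rw [← finsum_congr h2, ← h]
  simp only [pow_zero, mul_one, Ring.choose_zero_right, Int.cast_one, Nat.cast_zero, sub_zero,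
    zero_add]
  rw [neg_smul, smul_neg, neg_neg, ← zsmul_eq_cast_smul, smul_smul]
  have : ((l.negOnePow : ℤ) : ℂ) * (-1 : ℂ) ^ l = 1 := by
    rw [cast_negOnePow, ← zpow_add₀ (by norm_num), Even.neg_one_zpow ⟨l, rfl⟩]
  rw [this, one_smul]

/-- Skew symmetry turns Y_W(Y(a, z)b, x) into Y_W(e^{zD}Y(b, −z)a, x), translation replaces x by
φ(x, z), and associativity for (b, a) reads the result as a substitution into the product in the
other order. Hence both products have equal moments and are equal. -/
theorem IsInvAssoc.isLocal (A : VertexAlgebra V) {YW : V →ₗ[ℂ] VertexOperator ℂ W}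
    (h0 : IsVacuum A.one YW) (h : ∀ a b, ∃ k, IsInvAssoc A.Y YW k a b) {k : ℕ} {a b : V}
    (hab : IsInvAssoc A.Y YW k a b) (hba : IsInvAssoc A.Y YW k b a) : IsLocal YW k a b := by
  intro w
  set α := expand k (prodCoeff YW a b w) with hα
  set β := expand k (prodCoeff YW b a w) with hβ
  have hB : ∀ m n, expand k (swap (prodCoeff YW b a w)) m n = ((-1) ^ k : ℤ) • β n m :=
    fun m n => expand_nat_swap k _ n m
  have hBl : IsLaurent₂ (expand k (swap (prodCoeff YW b a w))) := by
    obtain ⟨N, hN⟩ := hba.laurent w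
    exact ⟨N, fun m n hmn => by rw [hB, hβ, hN _ _ hmn.symm, smul_zero]⟩
  refine (hab.laurent w).eq_of_moment hBl fun l p => ?_
  rcases lt_or_ge l 0 with hl | hl
  · rw [moment_eq_zero_of_neg _ hl, moment_eq_zero_of_neg _ hl]
  lift l to ℕ using hl
  -- The moment in the other variable: reverse the antidiagonal and reflect the binomial.
  have hR : moment (expand k (swap (prodCoeff YW b a w))) l p
      = ((-1) ^ k : ℤ) • ((-1) ^ l : ℤ) • ∑ᶠ ν : ℤ, bin (p - 1 - ν) l • β ν (p - l - ν) := by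
    rw [zsmul_finsum _ ((hba.laurent w).hasFiniteSupport _ _), moment,
      zsmul_finsum _ (((hba.laurent w).hasFiniteSupport
        (fun ν => ((-1) ^ l * bin (p - 1 - ν) l : ℤ)) (p - l)).subset fun ν => by
          simp only [Function.mem_support, mul_smul]; exact id),
      ← finsum_comp_equiv (Equiv.subLeft (p - l))]
    refine finsum_congr fun ν => ?_
    simp only [Equiv.subLeft_apply]
    rw [hB, sub_sub_cancel, bin_nat, bin_nat, choose_reflect (p - 1 - ν), smul_smul, smul_smul,
      smul_smul, mul_assoc ((-1) ^ k : ℤ), ← mul_assoc ((-1) ^ l : ℤ), ← pow_add,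
      Even.neg_one_pow ⟨l, rfl⟩, one_mul, mul_comm, hβ]
    congr 3
    ring
  obtain ⟨N, hN⟩ := exists_coeff_eq_zero (A.Y b) a
  have hz : ∀ i : ℕ, (k - l - 1 + i : ℤ) ≥ -N →
      VertexOperator.ncoeff (A.Y b) (k - l - 1 + i) a = 0 := fun i hi => hN _ (by omega)
  have hL : moment α l p = -((k - l - 1 : ℤ).negOnePow : ℤ) • ∑ᶠ i : ℕ, Ring.choose (p - 1) i •
      moment β (l - i) (p - i) := by
    rw [hab.moment_eq, show (l - k : ℤ) = -(k - l - 1) - 1 by ring, ← VertexOperator.ncoeff_apply,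
      A.skew]
    let T : V →+ W := ⟨⟨fun v => HVertexOperator.coeff (YW v) p w, by simp⟩, fun u v => by simp⟩
    change T _ = _
    rw [map_zsmul, T.map_finsum (hasFiniteSupport_of_le (N := (-N - (k - l - 1)).toNat)
      fun i hi => by
        rw [hz i (by omega), map_zero, map_zero, Pi.zero_apply, LinearMap.zero_apply, smul_zero])]
    congr 1
    refine finsum_congr fun i => ?_
    rw [map_zsmul]
    change _ • HVertexOperator.coeff (YW (HVertexOperator.coeff (A.Y _) i A.one)) p w = _
    -- Translation is applied to the vectors b_n a, which is why associativity is assumed for all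
    -- pairs.
    obtain ⟨k', hk'⟩ := h (VertexOperator.ncoeff (A.Y b) (k - l - 1 + i) a) A.one
    rw [coeff_translate A h0 hk', smul_smul, hba.moment_eq, choose_reflect (p - 1),
      show (i : ℤ) - 1 - (p - 1) = i - p by ring, VertexOperator.ncoeff_apply,
      show -(k - l - 1 + i : ℤ) - 1 = l - i - k by ring]
  have hs : -((k - l - 1 : ℤ).negOnePow : ℤ) = (-1) ^ k * (-1) ^ l := by
    rw [Int.negOnePow_sub, Int.negOnePow_sub, Int.negOnePow_one]
    simp [Int.coe_negOnePow_natCast]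
  have hM := finsum_bin_add (hba.laurent w) (p - 1) l (p - l)
  simp only [sub_add_cancel] at hM
  rw [hL, hR, hM, hs, mul_smul]

theorem exists_isInvAssoc_iff (A : VertexAlgebra V) {YW : V →ₗ[ℂ] VertexOperator ℂ W}
    (h0 : IsVacuum A.one YW) :
    (∀ a b, ∃ k, IsInvAssoc A.Y YW k a b) ↔ ∀ a b, InvJacobi A.Y YW a b := by
  constructor
  · intro h a b
    obtain ⟨k₁, h₁⟩ := h a b
    obtain ⟨k₂, h₂⟩ := h b a
    have h₁' := h₁.mono (le_max_left k₁ k₂)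
    exact ((IsInvAssoc.isLocal A h0 h h₁' (h₂.mono (le_max_right _ _))).isInvAssoc_iff A.Y).1 h₁'
  · intro h a b
    obtain ⟨k, hk⟩ := (h a b).exists_isLocal
    exact ⟨k, (hk.isInvAssoc_iff A.Y).2 (h a b)⟩

end Jacobi

end VertexOp

namespace VertexOp

namespace VertexOperatorAlgebra

variable {V : Type u} [AddCommGroup V] [Module ℂ V] (A : VertexOperatorAlgebra V)

/-! ### Commutators with `L(0)` and `L(1)` -/

theorem commutator (a b c : V) (m n : ℤ) :
    VertexOperator.ncoeff (A.Y a) m (VertexOperator.ncoeff (A.Y b) n c)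
      - VertexOperator.ncoeff (A.Y b) n (VertexOperator.ncoeff (A.Y a) m c)
    = ∑ᶠ i : ℕ, Ring.choose m i •
      VertexOperator.ncoeff (A.Y (VertexOperator.ncoeff (A.Y a) i b)) (m + n - i) c := by
  have h := A.jacobi a b c 0 m n
  rw [finsum_eq_single _ 0 fun i hi => by
      rw [Ring.choose_zero_pos _ (Nat.pos_of_ne_zero hi), Int.cast_zero, mul_zero, zero_smul],
    finsum_eq_single _ 0 fun i hi => by
      rw [Ring.choose_zero_pos _ (Nat.pos_of_ne_zero hi), Int.cast_zero, mul_zero, zero_smul]] at h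
  simpa [zsmul_eq_cast_smul] using h

theorem ncoeff_L_neg_one (a c : V) (n : ℤ) :
    VertexOperator.ncoeff (A.Y (VertexOperator.ncoeff (A.Y A.ω) 0 a)) n c
      = -n • VertexOperator.ncoeff (A.Y a) (n - 1) c := by
  rw [VertexOperator.ncoeff_apply, A.L_neg_one, LinearMap.smul_apply, ← zsmul_eq_cast_smul,
    VertexOperator.ncoeff_apply]
  congr 1
  · push_cast; ring
  · congr 3; ring_nf

theorem L_zero_ncoeff {p : ℤ} {a : V} (ha : a ∈ A.gr p) (b : V) (n : ℤ) :
    A.L 0 (VertexOperator.ncoeff (A.Y a) n b)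
      = VertexOperator.ncoeff (A.Y a) n (A.L 0 b)
        + (p - n - 1) • VertexOperator.ncoeff (A.Y a) n b := by
  have h := A.commutator A.ω a b 1 n
  rw [finsum_eq_sum_range (N := 2) fun i hi => by
    rw [choose_nat_of_lt (by norm_num) (by omega), zero_smul], Finset.sum_range_succ,
    Finset.sum_range_one] at h
  simp only [Ring.choose_zero_right, Ring.choose_one_right, one_smul, Nat.cast_zero, Nat.cast_one,
    ncoeff_L_neg_one, A.L_zero p a ha, zsmul_eq_cast_smul, map_zsmul,
    Pi.smul_apply, LinearMap.smul_apply, sub_zero] at h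
  rw [L, zero_add, sub_eq_iff_eq_add'.1 h, add_sub_cancel_left, ← add_smul]
  congr 2
  ring

theorem ncoeff_mem_gr {p q : ℤ} {a b : V} (ha : a ∈ A.gr p) (hb : b ∈ A.gr q) (n : ℤ) :
    VertexOperator.ncoeff (A.Y a) n b ∈ A.gr (p + q - n - 1) := by
  apply A.mem_gr_of_L_zero
  have h : A.L 0 b = (q : ℂ) • b := by simpa [L] using A.L_zero q b hb
  rw [A.L_zero_ncoeff ha, h, map_smul, zsmul_eq_cast_smul, zsmul_eq_cast_smul, ← add_smul]
  congr 1
  ring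

/-- The commutator formula for ω₂: its three terms come from L(−1)a, L(0)a and L(1)a, and the first
two combine into the middle coefficient. -/
theorem L_one_ncoeff {p : ℤ} {a : V} (ha : a ∈ A.gr p) (b : V) (n : ℤ) :
    A.L 1 (VertexOperator.ncoeff (A.Y a) n b)
      = VertexOperator.ncoeff (A.Y (A.L 1 a)) n b
        + (2 * p - n - 2) • VertexOperator.ncoeff (A.Y a) (n + 1) b
        + VertexOperator.ncoeff (A.Y a) n (A.L 1 b) := by
  have h := A.commutator A.ω a b 2 n
  rw [finsum_eq_sum_range (N := 3) fun i hi => by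
    rw [choose_nat_of_lt (by norm_num) (by omega), zero_smul], Finset.sum_range_succ,
    Finset.sum_range_succ, Finset.sum_range_one] at h
  have h2 : Ring.choose (2 : ℤ) 2 = 1 := by
    rw [show (2 : ℤ) = (2 : ℕ) from rfl, Ring.choose_natCast]; rfl
  simp only [Ring.choose_zero_right, Ring.choose_one_right, one_smul, Nat.cast_zero, Nat.cast_one,
    ncoeff_L_neg_one, A.L_zero p a ha, zsmul_eq_cast_smul, map_zsmul,
    Pi.smul_apply, LinearMap.smul_apply, sub_zero, h2, Nat.cast_ofNat] at h
  rw [L, show (1 : ℤ) + 1 = 2 from rfl, sub_eq_iff_eq_add'.1 h, add_sub_cancel_left,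
    show 2 + n - 1 = n + 1 by ring]
  module

/-! ### Divided powers of `L(1)` -/

/-- `L(1)^j / j!`. -/
noncomputable def dpow (j : ℕ) : Module.End ℂ V := (j.factorial : ℂ)⁻¹ • A.L 1 ^ j

theorem dpow_zero (a : V) : A.dpow 0 a = a := by simp [dpow]

theorem L_one_dpow (j : ℕ) (a : V) : A.L 1 (A.dpow j a) = (j + 1 : ℤ) • A.dpow (j + 1) a := by
  rw [dpow, dpow, LinearMap.smul_apply, LinearMap.smul_apply, map_smul, pow_succ',
    Module.End.mul_apply, ← zsmul_eq_cast_smul, smul_smul, Nat.factorial_succ]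
  congr 1
  have : ((j : ℂ) + 1) ≠ 0 := by exact_mod_cast Nat.succ_ne_zero j
  push_cast
  field_simp

theorem dpow_mem_gr {p : ℤ} {a : V} (ha : a ∈ A.gr p) (j : ℕ) : A.dpow j a ∈ A.gr (p - j) := by
  rw [dpow, LinearMap.smul_apply]
  refine Submodule.smul_mem _ _ ?_
  induction j with
  | zero => simpa using ha
  | succ j ih =>
    rw [pow_succ', Module.End.mul_apply]
    have := A.L_one_mem ih
    rwa [show p - (j : ℤ) - 1 = p - ((j + 1 : ℕ) : ℤ) by push_cast; ring] at this

theorem exists_dpow_eq_zero (a : V) : ∃ N : ℕ, ∀ j, N ≤ j → A.dpow j a = 0 := by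
  obtain ⟨N, hN⟩ := A.L_one_locally_nilpotent a
  exact ⟨N, fun j hj => by rw [dpow, LinearMap.smul_apply, hN j hj, smul_zero]⟩

theorem dpow_dpow (i j : ℕ) (a : V) :
    A.dpow i (A.dpow j a) = ((i + j).choose i : ℤ) • A.dpow (i + j) a := by
  rw [dpow, dpow, dpow, LinearMap.smul_apply, LinearMap.smul_apply, LinearMap.smul_apply, map_smul,
    ← Module.End.mul_apply, ← pow_add, smul_smul, ← zsmul_eq_cast_smul, smul_smul]
  congr 1
  have h1 : (i.factorial : ℂ) ≠ 0 := by exact_mod_cast i.factorial_ne_zero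
  have h2 : (j.factorial : ℂ) ≠ 0 := by exact_mod_cast j.factorial_ne_zero
  have h3 : ((i + j).factorial : ℂ) ≠ 0 := by exact_mod_cast (i + j).factorial_ne_zero
  have h4 : ((i + j).choose i : ℂ) * i.factorial * j.factorial = (i + j).factorial := by
    rw [Nat.choose_symm_add]
    exact_mod_cast Nat.add_choose_mul_factorial_mul_factorial i j
  push_cast
  field_simp
  rw [← h4]
  ring

theorem sum_antidiagonal_shift_fst {M : Type*} [AddCommGroup M] (f : ℕ → ℕ → M) (n : ℕ)
    (h : f 0 (n + 1) = 0) : ∑ ij ∈ Finset.HasAntidiagonal.antidiagonal n, f (ij.1 + 1) ij.2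
      = ∑ ij ∈ Finset.HasAntidiagonal.antidiagonal (n + 1), f ij.1 ij.2 := by
  rw [Finset.Nat.sum_antidiagonal_succ (f := fun ij => f ij.1 ij.2), h, zero_add]

theorem sum_antidiagonal_shift_snd {M : Type*} [AddCommGroup M] (f : ℕ → ℕ → M) (n : ℕ)
    (h : f (n + 1) 0 = 0) : ∑ ij ∈ Finset.HasAntidiagonal.antidiagonal n, f ij.1 (ij.2 + 1)
      = ∑ ij ∈ Finset.HasAntidiagonal.antidiagonal (n + 1), f ij.1 ij.2 := by
  rw [Finset.Nat.sum_antidiagonal_succ' (f := fun ij => f ij.1 ij.2), h, zero_add]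

/-- The induction step of `dpow_ncoeff` with the vertex operators abstracted away. After reindexing,
the coefficient of `X i s j` is brought to (i + s + j) times the binomial by Pascal's rule
(`bin_succ`) and absorption (`mul_bin`). -/
theorem map_sum_antidiagonal {M : Type*} [AddCommGroup M] (T : M →+ M) (X : ℕ → ℕ → ℕ → M) (q : ℤ)
    (hT : ∀ i s j : ℕ, T (X i s j) = ((i + 1 : ℕ) : ℤ) • X (i + 1) s j
        + (q - 2 * i - s - 2) • X i (s + 1) j + ((j + 1 : ℕ) : ℤ) • X i s (j + 1)) (N : ℕ) :
    T (∑ it ∈ Finset.HasAntidiagonal.antidiagonal N,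
        ∑ sj ∈ Finset.HasAntidiagonal.antidiagonal it.2,
          bin (q - it.1 - 2) sj.1 • X it.1 sj.1 sj.2)
      = (N + 1 : ℤ) • ∑ it ∈ Finset.HasAntidiagonal.antidiagonal (N + 1),
        ∑ sj ∈ Finset.HasAntidiagonal.antidiagonal it.2,
          bin (q - it.1 - 2) sj.1 • X it.1 sj.1 sj.2 := by
  have h1 : T (∑ it ∈ Finset.HasAntidiagonal.antidiagonal N,
        ∑ sj ∈ Finset.HasAntidiagonal.antidiagonal it.2,
          bin (q - it.1 - 2) sj.1 • X it.1 sj.1 sj.2)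
      = ∑ it ∈ Finset.HasAntidiagonal.antidiagonal (N + 1),
        ∑ sj ∈ Finset.HasAntidiagonal.antidiagonal it.2,
          ((it.1 * bin (q - it.1 - 1) sj.1
            + (q - 2 * it.1 - sj.1 - 1) * bin (q - it.1 - 2) (sj.1 - 1)
            + sj.2 * bin (q - it.1 - 2) sj.1 : ℤ)) • X it.1 sj.1 sj.2 := by
    simp only [map_sum, map_zsmul, add_smul, Finset.sum_add_distrib, hT, smul_add, smul_smul]
    congr 1
    · congr 1
      · rw [← sum_antidiagonal_shift_fst (fun i t => ∑ sj ∈ Finset.HasAntidiagonal.antidiagonal t,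
          (i * bin (q - i - 1) sj.1) • X i sj.1 sj.2) N (by simp)]
        refine Finset.sum_congr rfl fun it _ => Finset.sum_congr rfl fun sj _ => ?_
        push_cast
        rw [mul_comm, show q - ((it.1 : ℤ) + 1) - 1 = q - it.1 - 2 by ring]
      · rw [← sum_antidiagonal_shift_snd (fun i t => ∑ sj ∈ Finset.HasAntidiagonal.antidiagonal t,
          ((q - 2 * i - sj.1 - 1) * bin (q - i - 2) (sj.1 - 1)) • X i sj.1 sj.2) N
          (by simp [bin])]
        refine Finset.sum_congr rfl fun it _ => ?_
        rw [← sum_antidiagonal_shift_fst (fun s j => ((q - 2 * it.1 - s - 1)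
          * bin (q - it.1 - 2) (s - 1)) • X it.1 s j) _ (by simp [bin])]
        refine Finset.sum_congr rfl fun sj _ => ?_
        push_cast
        rw [mul_comm, add_sub_cancel_right,
          show q - 2 * (it.1 : ℤ) - (sj.1 + 1) - 1 = q - 2 * it.1 - sj.1 - 2 by ring]
    · rw [← sum_antidiagonal_shift_snd (fun i t => ∑ sj ∈ Finset.HasAntidiagonal.antidiagonal t,
          (sj.2 * bin (q - i - 2) sj.1) • X i sj.1 sj.2) N (by simp)]
      refine Finset.sum_congr rfl fun it _ => ?_
      rw [← sum_antidiagonal_shift_snd (fun s j => (j * bin (q - it.1 - 2) s) • X it.1 s j)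
        _ (by simp)]
      refine Finset.sum_congr rfl fun sj _ => ?_
      rw [mul_comm]
  rw [h1, Finset.smul_sum]
  refine Finset.sum_congr rfl fun it hit => ?_
  rw [Finset.smul_sum]
  refine Finset.sum_congr rfl fun sj hsj => ?_
  rw [Finset.HasAntidiagonal.mem_antidiagonal] at hit hsj
  rw [smul_smul]
  congr 1
  have e1 : (N + 1 : ℤ) = it.1 + sj.1 + sj.2 := by
    exact_mod_cast (by omega : N + 1 = it.1 + sj.1 + sj.2)
  have e2 := bin_succ (q - it.1 - 2) sj.1
  rw [show q - (it.1 : ℤ) - 2 + 1 = q - it.1 - 1 by ring] at e2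
  rw [e1, e2]
  linear_combination -mul_bin (q - it.1 - 2) sj.1

/-- The component form of
`e^{tL(1)} Y(a, z) e^{-tL(1)} = Y(e^{t(1-tz)L(1)} (1-tz)^{-2L(0)} a, z/(1-tz))`. -/
theorem dpow_ncoeff {p : ℤ} {a : V} (ha : a ∈ A.gr p) (b : V) (n : ℤ) (N : ℕ) :
    A.dpow N (VertexOperator.ncoeff (A.Y a) n b)
      = ∑ it ∈ Finset.HasAntidiagonal.antidiagonal N,
        ∑ sj ∈ Finset.HasAntidiagonal.antidiagonal it.2,
          bin (2 * p - n - it.1 - 2) sj.1 •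
            VertexOperator.ncoeff (A.Y (A.dpow it.1 a)) (n + sj.1) (A.dpow sj.2 b) := by
  induction N with
  | zero => simp [dpow_zero, bin]
  | succ N ih =>
    have h := map_sum_antidiagonal (A.L 1).toAddMonoidHom (fun i s j =>
      VertexOperator.ncoeff (A.Y (A.dpow i a)) (n + s) (A.dpow j b)) (2 * p - n) (fun i s j => by
        change A.L 1 _ = _
        rw [A.L_one_ncoeff (A.dpow_mem_gr ha i), A.L_one_dpow, A.L_one_dpow, map_zsmul, map_zsmul,
          map_zsmul, Pi.smul_apply, LinearMap.smul_apply, add_assoc n,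
          show 2 * (p - (i : ℤ)) - (n + s) - 2 = 2 * p - n - 2 * i - s - 2 by ring]
        push_cast
        rfl) N
    rw [← ih] at h
    change A.L 1 _ = _ at h
    rw [L_one_dpow, ← zsmul_eq_cast_smul, ← zsmul_eq_cast_smul] at h
    exact smul_right_injective V (r := (((N + 1 : ℤ)) : ℂ))
      (by exact_mod_cast Nat.succ_ne_zero N) h

end VertexOperatorAlgebra

end VertexOp

/-! ### The change of variables on homogeneous vectors and on the vacuum. -/

namespace VertexOp

namespace VertexOperatorAlgebra

variable {V : Type u} [AddCommGroup V] [Module ℂ V] (A : VertexOperatorAlgebra V)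
  {W : Type v} [AddCommGroup W] [Module ℂ W]

theorem gr_induction {P : V → Prop} (h0 : P 0) (hadd : ∀ a b, P a → P b → P (a + b))
    (hgr : ∀ p, ∀ a ∈ A.gr p, P a) (a : V) : P a := by
  classical
  rw [← A.decomp.symm_apply_apply a]
  induction A.decomp a using DirectSum.induction_on with
  | zero => rw [map_zero]; exact h0
  | add x y hx hy => rw [map_add]; exact hadd _ _ hx hy
  | of m x => rw [A.decomp_symm_of]; exact hgr m _ x.2

theorem decomp_of_mem {p : ℤ} {a : V} (ha : a ∈ A.gr p) :
    A.decomp a = DirectSum.lof ℂ ℤ (fun n => A.gr n) p ⟨a, ha⟩ := by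
  rw [← LinearEquiv.eq_symm_apply]
  exact (A.decomp_symm_of p ⟨a, ha⟩).symm

/-- Evaluation of `e^{xL(1)} (-x⁻²)^{L(0)} a` on a homogeneous vector. -/
theorem lsum_Phi {p : ℤ} {a : V} (ha : a ∈ A.gr p) (f : ℤ → V →ₗ[ℂ] W) :
    Finsupp.lsum ℂ f (A.Phi a) = (p.negOnePow : ℤ) • ∑ᶠ j : ℕ, f (j - 2 * p) (A.dpow j a) := by
  have h1 : A.negInvSqPowL0 a = ((-1 : ℂ) ^ p) • Finsupp.single (-2 * p) a := by
    rw [negInvSqPowL0, LinearMap.comp_apply, LinearEquiv.coe_coe, A.decomp_of_mem ha,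
      DirectSum.toModule_lof]
    rfl
  rw [Phi, LinearMap.comp_apply, h1, map_smul, map_smul, ← zsmul_eq_cast_smul, cast_negOnePow,
    Finsupp.lsum_single, LinearMap.comp_apply]
  congr 1
  let g : (ℤ →₀ V) →ₗ[ℂ] W :=
    (Finsupp.lsum ℂ f).comp (Finsupp.lmapDomain V ℂ fun j : ℤ => -2 * p + j)
  change g.toAddMonoidHom (∑ᶠ j : ℕ, Finsupp.single (j : ℤ) (A.dpow j a)) = _
  rw [AddMonoidHom.map_finsum (f := fun j : ℕ => Finsupp.single (j : ℤ) (A.dpow j a)) _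
    (A.expL1_finite a)]
  refine finsum_congr fun j => ?_
  change Finsupp.lsum ℂ f (Finsupp.mapDomain _ (Finsupp.single (j : ℤ) (A.dpow j a))) = _
  rw [Finsupp.mapDomain_single, Finsupp.lsum_single, show -2 * p + (j : ℤ) = j - 2 * p by ring]

/-- The coefficient of `x^n` in `Y_W(v, x)w`, as a linear map in `v`. -/
def coeffLin (YW : V →ₗ[ℂ] VertexOperator ℂ W) (n : ℤ) (w : W) : V →ₗ[ℂ] W where
  toFun v := HVertexOperator.coeff (YW v) n w
  map_add' u v := by simp
  map_smul' c v := by simp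

theorem coeff_newY_of_mem {p : ℤ} {a : V} (ha : a ∈ A.gr p) (YW : V →ₗ[ℂ] VertexOperator ℂ W)
    (n : ℤ) (w : W) : HVertexOperator.coeff (A.newY YW a) n w
      = (p.negOnePow : ℤ) • ∑ᶠ j : ℕ, HVertexOperator.coeff (YW (A.dpow j a)) (n + 2 * p - j) w := by
  rw [A.coeff_newY]
  have := A.lsum_Phi ha fun i => coeffLin YW (n - i) w
  rw [Finsupp.lsum_apply] at this
  refine this.trans ?_
  congr 1
  refine finsum_congr fun j => ?_
  change HVertexOperator.coeff _ _ _ = _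
  rw [show n - (j - 2 * p) = n + 2 * p - j by ring]

theorem ncoeff_newY_of_mem {p : ℤ} {a : V} (ha : a ∈ A.gr p) {I : ℕ}
    (hI : ∀ j, I ≤ j → A.dpow j a = 0) (YW : V →ₗ[ℂ] VertexOperator ℂ W)
    (n : ℤ) (w : W) : VertexOperator.ncoeff (A.newY YW a) n w
      = (p.negOnePow : ℤ) • ∑ j ∈ Finset.range I,
        HVertexOperator.coeff (YW (A.dpow j a)) (2 * p - n - 1 - j) w := by
  rw [VertexOperator.ncoeff_apply, A.coeff_newY_of_mem ha, finsum_eq_sum_range (N := I) fun j hj => by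
    rw [hI j hj, map_zero, map_zero, Pi.zero_apply, LinearMap.zero_apply]]
  congr 1
  refine Finset.sum_congr rfl fun j _ => ?_
  congr 2
  ring_nf

theorem one_mem_gr : A.one ∈ A.gr 0 := by
  apply A.mem_gr_of_L_zero
  rw [Int.cast_zero, zero_smul]
  exact A.creation_regular _ _ (by norm_num)

theorem dpow_one {j : ℕ} (hj : 1 ≤ j) : A.dpow j A.one = 0 := by
  obtain ⟨i, rfl⟩ := Nat.exists_eq_add_of_le' hj
  have h : A.L 1 A.one = 0 := A.creation_regular _ _ (by norm_num)
  rw [dpow, LinearMap.smul_apply, pow_succ, Module.End.mul_apply, h, map_zero, smul_zero]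

/-- The vacuum has weight 0 and is killed by L(1), so the change of variables fixes it. -/
theorem coeff_newY_one (YW : V →ₗ[ℂ] VertexOperator ℂ W) (n : ℤ) :
    HVertexOperator.coeff (A.newY YW A.one) n = HVertexOperator.coeff (YW A.one) n := by
  ext w
  rw [A.coeff_newY_of_mem A.one_mem_gr, finsum_eq_single _ 0 fun j hj => by
    rw [A.dpow_one (Nat.one_le_iff_ne_zero.2 hj), map_zero, map_zero, Pi.zero_apply,
      LinearMap.zero_apply], dpow_zero]
  simp

theorem isVacuum_newY_iff (YW : V →ₗ[ℂ] VertexOperator ℂ W) :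
    IsVacuum A.one (A.newY YW) ↔ IsVacuum A.one YW := by
  simp only [IsVacuum, coeff_newY_one]

end VertexOperatorAlgebra

end VertexOp

/-! ### The three terms of the Jacobi identity under the change of variables. -/

namespace VertexOp

namespace VertexOperatorAlgebra

variable {V : Type u} [AddCommGroup V] [Module ℂ V] (A : VertexOperatorAlgebra V)
  {W : Type v} [AddCommGroup W] [Module ℂ W]

theorem hasFiniteSupport_sum {M ι κ : Type*} [AddCommGroup M] (s : Finset ι) {f : ι → κ → M}
    (h : ∀ i, (f i).HasFiniteSupport) : (fun k => ∑ i ∈ s, f i k).HasFiniteSupport := by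
  refine (s.finite_toSet.biUnion fun i _ => h i).subset fun k hk => ?_
  obtain ⟨i, hi, hi'⟩ := Finset.exists_ne_zero_of_sum_ne_zero hk
  exact Set.mem_biUnion hi hi'

theorem finsum_zsmul_sum_sum {M κ : Type*} [AddCommGroup M] (c : ℤ) (I J : ℕ) {f : ℕ → ℕ → κ → M}
    (h : ∀ i j, (f i j).HasFiniteSupport) :
    ∑ᶠ k, c • ∑ i ∈ Finset.range I, ∑ j ∈ Finset.range J, f i j k
      = c • ∑ i ∈ Finset.range I, ∑ j ∈ Finset.range J, ∑ᶠ k, f i j k := by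
  have h' := fun i => hasFiniteSupport_sum (Finset.range J) (h i)
  rw [← zsmul_finsum c (hasFiniteSupport_sum (Finset.range I) h'), finsum_sum_comm _ _ fun i _ => h' i]
  congr 1
  exact Finset.sum_congr rfl fun i _ => finsum_sum_comm _ _ fun j _ => h i j

theorem hasFiniteSupport_prodCoeff (YW : V →ₗ[ℂ] VertexOperator ℂ W) (a b : V) (w : W) (c : ℕ → ℤ)
    (M N : ℤ) : (fun r : ℕ => c r • swap (prodCoeff YW a b w) (M - r) (N + r)).HasFiniteSupport := by
  obtain ⟨K, hK⟩ := exists_prodCoeff_eq_zero YW a b w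
  exact hasFiniteSupport_of_le (N := (M - K + 1).toNat) fun r hr => by
    rw [swap, hK _ _ (by omega), smul_zero]

/-- Here x₁^{l−r}x₂^r = (x₁x₂)^l y₂^{l−r}y₁^r, so an expansion in nonnegative powers of x₂ is one in
nonnegative powers of y₁. This exchanges the variables and puts −l into both indices. -/
theorem finsum_ncoeff_newY_newY {p q : ℤ} {a b : V} (ha : a ∈ A.gr p) (hb : b ∈ A.gr q) {I J : ℕ}
    (hI : ∀ j, I ≤ j → A.dpow j a = 0) (hJ : ∀ j, J ≤ j → A.dpow j b = 0)
    (YW : V →ₗ[ℂ] VertexOperator ℂ W) (w : W) (l m n : ℤ) :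
    ∑ᶠ r : ℕ, ((-1) ^ r * Ring.choose l r : ℤ) • VertexOperator.ncoeff (A.newY YW a) (m + l - r)
        (VertexOperator.ncoeff (A.newY YW b) (n + r) w)
      = ((p + q).negOnePow : ℤ) • ∑ i ∈ Finset.range I, ∑ j ∈ Finset.range J,
        expand l (swap (prodCoeff YW (A.dpow i a) (A.dpow j b) w))
          (2 * q - n - l - 1 - j) (2 * p - m - l - 1 - i) := by
  have h : ∀ r : ℕ, ((-1) ^ r * Ring.choose l r : ℤ) •
      VertexOperator.ncoeff (A.newY YW a) (m + l - r)
        (VertexOperator.ncoeff (A.newY YW b) (n + r) w)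
      = ((p + q).negOnePow : ℤ) • ∑ i ∈ Finset.range I, ∑ j ∈ Finset.range J,
        ((-1) ^ r * Ring.choose l r : ℤ) • swap (prodCoeff YW (A.dpow i a) (A.dpow j b) w)
          (2 * q - n - l - 1 - j + l - r) (2 * p - m - l - 1 - i + r) := by
    intro r
    generalize ((-1) ^ r * Ring.choose l r : ℤ) = c
    rw [A.ncoeff_newY_of_mem ha hI, A.ncoeff_newY_of_mem hb hJ, smul_comm, Int.negOnePow_add,
      Units.val_mul, mul_smul]
    simp only [map_zsmul, map_sum, Finset.smul_sum]
    refine Finset.sum_congr rfl fun i _ => Finset.sum_congr rfl fun j _ => ?_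
    rw [smul_comm c, swap, prodCoeff, show 2 * p - (m + l - r) - 1 - i = 2 * p - m - l - 1 - i + (r : ℤ) by ring,
      show 2 * q - (n + r) - 1 - j = 2 * q - n - l - 1 - j + l - (r : ℤ) by ring]
  rw [finsum_congr h, finsum_zsmul_sum_sum _ _ _ fun i j => hasFiniteSupport_prodCoeff YW
    (A.dpow i a) (A.dpow j b) w (fun r => ((-1) ^ r * Ring.choose l r : ℤ))
    (2 * q - n - l - 1 - j + l) (2 * p - m - l - 1 - i)]
  rfl

/-- Summing `dpow_ncoeff` over N frees the three indices; nilpotency bounds i and j, and `hS` bounds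
s. -/
theorem finsum_dpow_ncoeff {M : Type*} [AddCommGroup M] {p : ℤ} {a : V} (ha : a ∈ A.gr p) (b : V) {I J : ℕ}
    (hI : ∀ j, I ≤ j → A.dpow j a = 0) (hJ : ∀ j, J ≤ j → A.dpow j b = 0) (n : ℤ) {S : ℕ}
    (hS : ∀ i j s : ℕ, S ≤ s →
      VertexOperator.ncoeff (A.Y (A.dpow i a)) (n + s) (A.dpow j b) = 0) (g : ℕ → V →+ M) :
    ∑ᶠ N : ℕ, g N (A.dpow N (VertexOperator.ncoeff (A.Y a) n b))
      = ∑ i ∈ Finset.range I, ∑ j ∈ Finset.range J, ∑ᶠ s : ℕ,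
        Ring.choose (2 * p - n - i - 2) s • g (i + s + j)
          (VertexOperator.ncoeff (A.Y (A.dpow i a)) (n + s) (A.dpow j b)) := by
  set X : ℕ → ℕ → ℕ → M := fun i s j => Ring.choose (2 * p - n - i - 2) s • g (i + s + j)
          (VertexOperator.ncoeff (A.Y (A.dpow i a)) (n + s) (A.dpow j b)) with hX
  have hXI : ∀ i s j, I ≤ i → X i s j = 0 := fun i s j h => by
    simp [hX, hI i h]
  have hXJ : ∀ i s j, J ≤ j → X i s j = 0 := fun i s j h => by
    simp [hX, hJ j h]
  have hXS : ∀ i s j, S ≤ s → X i s j = 0 := fun i s j h => by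
    simp only [hX, hS i j s h, map_zero, smul_zero]
  have h1 : ∀ N, g N (A.dpow N (VertexOperator.ncoeff (A.Y a) n b))
      = ∑ it ∈ Finset.HasAntidiagonal.antidiagonal N,
        ∑ sj ∈ Finset.HasAntidiagonal.antidiagonal it.2, X it.1 sj.1 sj.2 := by
    intro N
    rw [A.dpow_ncoeff ha, map_sum]
    refine Finset.sum_congr rfl fun it hit => ?_
    rw [map_sum]
    refine Finset.sum_congr rfl fun sj hsj => ?_
    rw [Finset.HasAntidiagonal.mem_antidiagonal] at hit hsj
    rw [map_zsmul, bin_nat, ← hit, ← hsj, ← add_assoc]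
  rw [finsum_congr h1, finsum_sum_antidiagonal (N := I + S + J) (f := fun i t =>
      ∑ sj ∈ Finset.HasAntidiagonal.antidiagonal t, X i sj.1 sj.2) fun i t hit =>
        Finset.sum_eq_zero fun sj hsj => ?_,
    finsum_eq_sum_range (N := I) fun i hi => finsum_eq_zero_of_forall fun t =>
      Finset.sum_eq_zero fun sj _ => hXI _ _ _ hi]
  · refine Finset.sum_congr rfl fun i _ => ?_
    rw [finsum_sum_antidiagonal (N := S + J) (f := X i) fun s j hsj => ?_]
    · have h2 : ∀ s, ∑ᶠ j, X i s j = ∑ j ∈ Finset.range J, X i s j := fun s =>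
        finsum_eq_sum_range fun j hj => hXJ i s j hj
      rw [finsum_congr h2, finsum_sum_comm _ _ fun j _ => hasFiniteSupport_of_le (N := S)
        fun s hs => hXS i s j hs]
    · rcases le_or_gt S s with h | h
      · exact hXS _ _ _ h
      · exact hXJ _ _ _ (by omega)
  · rw [Finset.HasAntidiagonal.mem_antidiagonal] at hsj
    rcases le_or_gt I i with h | h
    · exact hXI _ _ _ h
    rcases le_or_gt S sj.1 with h' | h'
    · exact hXS _ _ _ h'
    · exact hXJ _ _ _ (by omega)

theorem exists_ncoeff_dpow_eq_zero (a b : V) (n : ℤ) : ∃ S : ℕ, ∀ i j s : ℕ, S ≤ s →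
    VertexOperator.ncoeff (A.Y (A.dpow i a)) (n + s) (A.dpow j b) = 0 := by
  obtain ⟨I, hI⟩ := A.exists_dpow_eq_zero a
  obtain ⟨J, hJ⟩ := A.exists_dpow_eq_zero b
  choose N hN using fun i j : ℕ => exists_coeff_eq_zero (A.Y (A.dpow i a)) (A.dpow j b)
  -- Only finitely many pairs matter; a sum of natural numbers serves as their common bound.
  refine ⟨∑ i ∈ Finset.range I, ∑ j ∈ Finset.range J, (-N i j - n).toNat, fun i j s hs => ?_⟩
  rcases le_or_gt I i with h | h
  · simp [hI i h]
  rcases le_or_gt J j with h' | h'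
  · simp [hJ j h']
  have h1 : (-N i j - n).toNat ≤ s := by
    refine le_trans ?_ hs
    refine le_trans ?_ (Finset.single_le_sum (f := fun i => ∑ j ∈ Finset.range J,
      (-N i j - n).toNat) (fun _ _ => Nat.zero_le _) (Finset.mem_range.2 h))
    exact Finset.single_le_sum (f := fun j => (-N i j - n).toNat) (fun _ _ => Nat.zero_le _)
      (Finset.mem_range.2 h')
  exact hN i j _ (by omega)

/-- The conjugation formula carries e^{xL(1)} inside Y(a, x₀)b. Its binomial combines with that of
the Jacobi identity into the single one required by `InvJacobi`. -/
theorem finsum_newY_ncoeff {p q : ℤ} {a b : V} (ha : a ∈ A.gr p) (hb : b ∈ A.gr q) {I J : ℕ}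
    (hI : ∀ j, I ≤ j → A.dpow j a = 0) (hJ : ∀ j, J ≤ j → A.dpow j b = 0)
    (YW : V →ₗ[ℂ] VertexOperator ℂ W) (w : W) (l m n : ℤ) :
    ∑ᶠ r : ℕ, Ring.choose m r • VertexOperator.ncoeff
        (A.newY YW (VertexOperator.ncoeff (A.Y a) (l + r) b)) (m + n - r) w
      = -((l + p + q).negOnePow : ℤ) • ∑ i ∈ Finset.range I, ∑ j ∈ Finset.range J,
        ∑ᶠ r : ℕ, Ring.choose (2 * p - m - l - 1 - i - 1) r • HVertexOperator.coeff
          (YW (VertexOperator.ncoeff (A.Y (A.dpow i a)) (l + r) (A.dpow j b)))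
          (2 * p - m - l - 1 - i + (2 * q - n - l - 1 - j) - 1 - r) w := by
  obtain ⟨S, hS⟩ := A.exists_ncoeff_dpow_eq_zero a b l
  set G : ℕ → ℕ → ℕ → W := fun i j r => HVertexOperator.coeff
    (YW (VertexOperator.ncoeff (A.Y (A.dpow i a)) (l + r) (A.dpow j b)))
    (2 * p - m - l - 1 - i + (2 * q - n - l - 1 - j) - 1 - r) w with hG
  have hGS : ∀ i j r, S ≤ r → G i j r = 0 := fun i j r hr => by
    simp only [hG, hS i j r hr, map_zero, Pi.zero_apply, LinearMap.zero_apply]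
  have h1 : ∀ r : ℕ, Ring.choose m r • VertexOperator.ncoeff
        (A.newY YW (VertexOperator.ncoeff (A.Y a) (l + r) b)) (m + n - r) w
      = -((l + p + q).negOnePow : ℤ) • ∑ i ∈ Finset.range I, ∑ j ∈ Finset.range J,
        ∑ᶠ s : ℕ, ((-1) ^ r * Ring.choose m r * Ring.choose (2 * p - l - i - 2 - r) s : ℤ) •
          G i j (r + s) := by
    intro r
    have hc := A.ncoeff_mem_gr ha hb (l + r)
    rw [VertexOperator.ncoeff_apply, A.coeff_newY_of_mem hc]
    have h2 := A.finsum_dpow_ncoeff ha b hI hJ (l + r) (S := S) (fun i j s hs => by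
      have := hS i j (r + s) (by omega)
      rwa [show l + (r : ℤ) + s = l + ((r + s : ℕ) : ℤ) by push_cast; ring]) fun N =>
        (coeffLin YW (-(m + n - r) - 1 + 2 * (p + q - (l + r) - 1) - N) w).toAddMonoidHom
    -- The sign comes from (−1)^{L(0)} on a_{l+r} b, whose weight is p + q − (l + r) − 1. The
    -- leftover (−1)^r is what the Vandermonde sum needs.
    have h3 : ((p + q - (l + r) - 1).negOnePow : ℤ) = -((l + p + q).negOnePow : ℤ) * (-1) ^ r := by
      rw [Int.negOnePow_sub, Int.negOnePow_sub, Int.negOnePow_add l r, add_assoc,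
        Int.negOnePow_add l, Int.negOnePow_one]
      simp only [Units.val_mul, Units.val_neg, Units.val_one, Int.coe_negOnePow_natCast]
      ring
    refine (congrArg (fun x => Ring.choose m r • ((p + q - (l + r) - 1).negOnePow : ℤ) • x)
      h2).trans ?_
    rw [h3, mul_smul, smul_comm]
    congr 1
    rw [Finset.smul_sum, Finset.smul_sum]
    refine Finset.sum_congr rfl fun i _ => ?_
    rw [Finset.smul_sum, Finset.smul_sum]
    refine Finset.sum_congr rfl fun j _ => ?_
    have h4 : ∀ s : ℕ, coeffLin YW (-(m + n - r) - 1 + 2 * (p + q - (l + r) - 1) - (i + s + j : ℕ)) w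
        (VertexOperator.ncoeff (A.Y (A.dpow i a)) (l + r + s) (A.dpow j b)) = G i j (r + s) := by
      intro s
      change HVertexOperator.coeff _ _ _ = _
      simp only [hG]
      push_cast
      rw [add_assoc l]
      congr 2
      ring_nf
    have h5 : (fun s : ℕ => Ring.choose (2 * p - (l + r) - i - 2) s •
        G i j (r + s)).HasFiniteSupport :=
      hasFiniteSupport_of_le (N := S) fun s hs => by rw [hGS _ _ _ (by omega), smul_zero]
    have h6 : (fun s : ℕ => ((-1) ^ r : ℤ) • Ring.choose (2 * p - (l + r) - i - 2) s •
        G i j (r + s)).HasFiniteSupport :=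
      hasFiniteSupport_of_le (N := S) fun s hs => by
        rw [hGS _ _ _ (by omega), smul_zero, smul_zero]
    change Ring.choose m r • ((-1) ^ r : ℤ) • ∑ᶠ s : ℕ, _ • coeffLin YW _ w _ = _
    simp only [h4]
    rw [zsmul_finsum _ h5, zsmul_finsum _ h6]
    refine finsum_congr fun s => ?_
    rw [smul_smul, smul_smul, mul_comm ((-1) ^ r : ℤ),
      show 2 * p - (l + r) - i - 2 = 2 * p - l - i - 2 - (r : ℤ) by ring]
  rw [finsum_congr h1, finsum_zsmul_sum_sum _ _ _ fun i j => hasFiniteSupport_of_le (N := S)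
    fun r hr => finsum_eq_zero_of_forall fun s => by rw [hGS _ _ _ (by omega), smul_zero]]
  congr 1
  refine Finset.sum_congr rfl fun i _ => ?_
  refine Finset.sum_congr rfl fun j _ => ?_
  rw [← finsum_sum_antidiagonal (N := S) fun r s hrs => by rw [hGS _ _ _ hrs, smul_zero]]
  refine finsum_congr fun R => ?_
  rw [show 2 * p - m - l - 1 - i - 1 = 2 * p - l - (i : ℤ) - 2 - m by ring,
    ← sum_choose_mul_choose_sub, Finset.sum_smul]
  refine Finset.sum_congr rfl fun rs hrs => ?_
  rw [Finset.HasAntidiagonal.mem_antidiagonal] at hrs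
  rw [← hrs]

end VertexOperatorAlgebra

end VertexOp

/-! ### Jacobi identities as vanishing of biadditive maps, so that homogeneous vectors suffice. -/

namespace VertexOp

section Defect

variable {V : Type u} [AddCommGroup V] [Module ℂ V] {W : Type v} [AddCommGroup W] [Module ℂ W]

theorem hasFiniteSupport_pair (YW : V →ₗ[ℂ] VertexOperator ℂ W) (w : W) (c d : ℕ → ℤ) (e : ℤ)
    (a b : V) : (fun i : ℕ => c i • HVertexOperator.coeff (YW a) (d i)
      (HVertexOperator.coeff (YW b) (e - i) w)).HasFiniteSupport := by
  obtain ⟨N, hN⟩ := exists_coeff_eq_zero (YW b) w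
  exact hasFiniteSupport_of_le (N := (e - N + 1).toNat) fun i hi => by
    rw [hN _ (by omega), map_zero, smul_zero]

/-- `∑_i c_i Y_W(a, x)_{d_i} Y_W(b, x)_{e-i} w`, as a biadditive map in `a`, `b`. -/
noncomputable def pairHom (YW : V →ₗ[ℂ] VertexOperator ℂ W) (w : W) (c d : ℕ → ℤ) (e : ℤ) :
    V →+ V →+ W :=
  AddMonoidHom.mk' (fun a => AddMonoidHom.mk' (fun b => ∑ᶠ i : ℕ, c i •
      HVertexOperator.coeff (YW a) (d i) (HVertexOperator.coeff (YW b) (e - i) w)) fun b b' => by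
    rw [← finsum_add_distrib (hasFiniteSupport_pair ..) (hasFiniteSupport_pair ..)]
    refine finsum_congr fun i => ?_
    rw [← smul_add, ← map_add]
    simp only [map_add, Pi.add_apply, LinearMap.add_apply]) fun a a' => by
    ext b
    simp only [AddMonoidHom.add_apply, AddMonoidHom.mk'_apply]
    rw [← finsum_add_distrib (hasFiniteSupport_pair ..) (hasFiniteSupport_pair ..)]
    refine finsum_congr fun i => ?_
    rw [← smul_add, map_add, map_add, Pi.add_apply, LinearMap.add_apply]

theorem hasFiniteSupport_iter (Y : V →ₗ[ℂ] VertexOperator ℂ V) (YW : V →ₗ[ℂ] VertexOperator ℂ W)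
    (w : W) (c d : ℕ → ℤ) (l : ℤ) (a b : V) : (fun i : ℕ => c i • HVertexOperator.coeff
      (YW (VertexOperator.ncoeff (Y a) (l + i) b)) (d i) w).HasFiniteSupport := by
  obtain ⟨N, hN⟩ := exists_coeff_eq_zero (Y a) b
  exact hasFiniteSupport_of_le (N := (-N - l).toNat) fun i hi => by
    rw [VertexOperator.ncoeff_apply, hN _ (by omega), map_zero, map_zero, Pi.zero_apply,
      LinearMap.zero_apply, smul_zero]

/-- `∑_i c_i Y_W(a_{l+i} b, x)_{d_i} w`, as a biadditive map in `a`, `b`. -/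
noncomputable def iterHom (Y : V →ₗ[ℂ] VertexOperator ℂ V) (YW : V →ₗ[ℂ] VertexOperator ℂ W) (w : W)
    (c d : ℕ → ℤ) (l : ℤ) : V →+ V →+ W :=
  AddMonoidHom.mk' (fun a => AddMonoidHom.mk' (fun b => ∑ᶠ i : ℕ, c i •
      HVertexOperator.coeff (YW (VertexOperator.ncoeff (Y a) (l + i) b)) (d i) w) fun b b' => by
    rw [← finsum_add_distrib (hasFiniteSupport_iter ..) (hasFiniteSupport_iter ..)]
    refine finsum_congr fun i => ?_
    rw [← smul_add, map_add, map_add, map_add, Pi.add_apply, LinearMap.add_apply]) fun a a' => by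
    ext b
    simp only [AddMonoidHom.add_apply, AddMonoidHom.mk'_apply]
    rw [← finsum_add_distrib (hasFiniteSupport_iter ..) (hasFiniteSupport_iter ..)]
    refine finsum_congr fun i => ?_
    rw [← smul_add, map_add, map_add, Pi.add_apply, LinearMap.add_apply, map_add, map_add,
      Pi.add_apply, LinearMap.add_apply]

/-- The difference of the two sides of a component of the Jacobi identity. -/
noncomputable def jacobiDefect (Y : V →ₗ[ℂ] VertexOperator ℂ V) (YW : V →ₗ[ℂ] VertexOperator ℂ W)
    (w : W) (l m n : ℤ) : V →+ V →+ W :=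
  pairHom YW w (fun i => (-1) ^ i * Ring.choose l i) (fun i => -(m + l - i) - 1) (-n - 1)
    - (l.negOnePow : ℤ) • (pairHom YW w (fun i => (-1) ^ i * Ring.choose l i)
      (fun i => -(n + l - i) - 1) (-m - 1)).flip
    - iterHom Y YW w (Ring.choose m) (fun i => -(m + n - i) - 1) l

theorem jacobiDefect_apply (Y : V →ₗ[ℂ] VertexOperator ℂ V) (YW : V →ₗ[ℂ] VertexOperator ℂ W)
    (w : W) (l m n : ℤ) (a b : V) : jacobiDefect Y YW w l m n a b
      = ∑ᶠ i : ℕ, ((-1) ^ i * Ring.choose l i : ℤ) • VertexOperator.ncoeff (YW a) (m + l - i)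
          (VertexOperator.ncoeff (YW b) (n + i) w)
        - (l.negOnePow : ℤ) • ∑ᶠ i : ℕ, ((-1) ^ i * Ring.choose l i : ℤ) •
          VertexOperator.ncoeff (YW b) (n + l - i) (VertexOperator.ncoeff (YW a) (m + i) w)
        - ∑ᶠ i : ℕ, Ring.choose m i •
          VertexOperator.ncoeff (YW (VertexOperator.ncoeff (Y a) (l + i) b)) (m + n - i) w := by
  have h : ∀ (k : ℤ) (i : ℕ), -(k + i) - 1 = -k - 1 - i := fun k i => by ring
  simp only [VertexOperator.ncoeff_apply (YW _), h]
  rfl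

theorem jacobiIdentity_iff (Y : V →ₗ[ℂ] VertexOperator ℂ V) (YW : V →ₗ[ℂ] VertexOperator ℂ W) :
    JacobiIdentity Y YW ↔ ∀ w l m n a b, jacobiDefect Y YW w l m n a b = 0 := by
  have h : ∀ a b w l m n, (∑ᶠ i : ℕ, ((-1 : ℂ) ^ i * ((Ring.choose l i : ℤ) : ℂ)) •
        VertexOperator.ncoeff (YW a) (m + l - i) (VertexOperator.ncoeff (YW b) (n + i) w))
      - (∑ᶠ i : ℕ, ((-1 : ℂ) ^ l * (-1 : ℂ) ^ i * ((Ring.choose l i : ℤ) : ℂ)) •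
        VertexOperator.ncoeff (YW b) (n + l - i) (VertexOperator.ncoeff (YW a) (m + i) w))
      - ∑ᶠ i : ℕ, ((Ring.choose m i : ℤ) : ℂ) •
        VertexOperator.ncoeff (YW (VertexOperator.ncoeff (Y a) (l + i) b)) (m + n - i) w
      = jacobiDefect Y YW w l m n a b := by
    intro a b w l m n
    have h' : ∀ i : ℕ, -(m + i) - 1 = -m - 1 - i := fun i => by ring
    have hfin := hasFiniteSupport_pair YW w (fun i => (-1) ^ i * Ring.choose l i)
      (fun i => -(n + l - i) - 1) (-m - 1) b a
    rw [jacobiDefect_apply, zsmul_finsum _ (by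
      simpa only [VertexOperator.ncoeff_apply, h'] using hfin)]
    congr 1
    · congr 1
      · refine finsum_congr fun i => ?_
        rw [← zsmul_eq_cast_smul]
        push_cast
        rfl
      · refine finsum_congr fun i => ?_
        rw [smul_smul, ← zsmul_eq_cast_smul, ← mul_assoc, Int.cast_mul, Int.cast_mul,
          cast_negOnePow]
        push_cast
        rfl
    · refine finsum_congr fun i => ?_
      rw [← zsmul_eq_cast_smul]
  constructor
  · intro hJ w l m n a b
    rw [← h, hJ, sub_self]
  · intro hD a b w l m n
    rw [← sub_eq_zero, h, hD]

/-- The difference of the two sides of a component of `InvJacobi`. -/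
noncomputable def invDefect (Y : V →ₗ[ℂ] VertexOperator ℂ V) (YW : V →ₗ[ℂ] VertexOperator ℂ W)
    (w : W) (l m n : ℤ) : V →+ V →+ W :=
  (pairHom YW w (fun i => (-1) ^ i * Ring.choose l i) (fun i => n + i) (m + l)).flip
    - (l.negOnePow : ℤ) • pairHom YW w (fun i => (-1) ^ i * Ring.choose l i)
      (fun i => m + i) (n + l)
    - iterHom Y YW w (Ring.choose (m - 1)) (fun i => m + n - 1 - i) l

theorem invDefect_apply (Y : V →ₗ[ℂ] VertexOperator ℂ V) (YW : V →ₗ[ℂ] VertexOperator ℂ W)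
    (w : W) (l m n : ℤ) (a b : V) : invDefect Y YW w l m n a b
      = expand l (swap (prodCoeff YW b a w)) m n
        - (l.negOnePow : ℤ) • expand l (swap (prodCoeff YW a b w)) n m
        - ∑ᶠ i : ℕ, Ring.choose (m - 1) i •
          HVertexOperator.coeff (YW (VertexOperator.ncoeff (Y a) (l + i) b)) (m + n - 1 - i) w :=
  rfl

theorem invJacobi_iff (Y : V →ₗ[ℂ] VertexOperator ℂ V) (YW : V →ₗ[ℂ] VertexOperator ℂ W) (a b : V) :
    InvJacobi Y YW a b ↔ ∀ w l m n, invDefect Y YW w l m n a b = 0 := by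
  simp only [invDefect_apply, sub_eq_zero, InvJacobi]

end Defect

/-! ### Comparison of the two Jacobi identities. -/

namespace VertexOperatorAlgebra

variable {V : Type u} [AddCommGroup V] [Module ℂ V] (A : VertexOperatorAlgebra V)
  {W : Type v} [AddCommGroup W] [Module ℂ W]

theorem biadditive_eq_zero {M : Type*} [AddCommGroup M] (D : V →+ V →+ M)
    (h : ∀ p q, ∀ a ∈ A.gr p, ∀ b ∈ A.gr q, D a b = 0) (a b : V) : D a b = 0 := by
  refine A.gr_induction (P := fun a => D a b = 0) (by simp)
    (fun a a' h h' => by rw [map_add, AddMonoidHom.add_apply, h, h', add_zero])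
    (fun p a ha => ?_) a
  exact A.gr_induction (P := fun b => D a b = 0) (by simp)
    (fun b b' h h' => by rw [map_add, h, h', add_zero]) (fun q b hb => h p q a ha b hb) b

/-- All three terms transform by the same finite sum. The two products trade places, which accounts
for the factor (−1)^l between their signs. The summand i = j = 0 involves a and b themselves. -/
theorem jacobiDefect_newY {p q : ℤ} {a b : V} (ha : a ∈ A.gr p) (hb : b ∈ A.gr q) {I J : ℕ}
    (hI : ∀ j, I ≤ j → A.dpow j a = 0) (hJ : ∀ j, J ≤ j → A.dpow j b = 0)
    (YW : V →ₗ[ℂ] VertexOperator ℂ W) (w : W) (l m n : ℤ) :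
    jacobiDefect A.Y (A.newY YW) w l m n a b
      = -((l + p + q).negOnePow : ℤ) • ∑ i ∈ Finset.range I, ∑ j ∈ Finset.range J,
        invDefect A.Y YW w l (2 * p - m - l - 1 - i) (2 * q - n - l - 1 - j)
          (A.dpow i a) (A.dpow j b) := by
  rw [jacobiDefect_apply, A.finsum_ncoeff_newY_newY ha hb hI hJ,
    A.finsum_ncoeff_newY_newY hb ha hJ hI, A.finsum_newY_ncoeff ha hb hI hJ, Finset.sum_comm
      (s := Finset.range J)]
  simp only [invDefect_apply, Finset.sum_sub_distrib, ← Finset.smul_sum]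
  have h1 : ((l + p + q).negOnePow : ℤ) = l.negOnePow * (p + q).negOnePow := by
    rw [add_assoc, Int.negOnePow_add, Units.val_mul]
  have h2 : (l.negOnePow : ℤ) * l.negOnePow = 1 := by
    rw [← Units.val_mul, ← Int.negOnePow_add, Int.negOnePow_even _ ⟨l, rfl⟩, Units.val_one]
  rw [smul_sub, smul_sub, smul_smul, smul_smul, add_comm q p, h1,
    show -((l.negOnePow : ℤ) * ((p + q).negOnePow : ℤ)) * (l.negOnePow : ℤ)
      = -((p + q).negOnePow : ℤ) by linear_combination -((p + q).negOnePow : ℤ) * h2]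
  module

theorem isPhiModule_iff_isModule_newY (YW : V →ₗ[ℂ] VertexOperator ℂ W)
    (h0 : IsVacuum A.one YW) :
    IsPhiModule phi A.toVertexAlgebra YW ↔ IsModule A.toVertexAlgebra (A.newY YW) := by
  have h1 : IsModule A.toVertexAlgebra (A.newY YW) ↔ JacobiIdentity A.Y (A.newY YW) :=
    ⟨fun h => h.jacobi, fun h => ⟨(A.isVacuum_newY_iff YW).2 h0, h⟩⟩
  rw [isPhiModule_iff, h1, and_iff_right h0, exists_isInvAssoc_iff _ h0, jacobiIdentity_iff]
  constructor
  · intro h w l m n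
    refine A.biadditive_eq_zero _ fun p q a ha b hb => ?_
    obtain ⟨I, hI⟩ := A.exists_dpow_eq_zero a
    obtain ⟨J, hJ⟩ := A.exists_dpow_eq_zero b
    rw [A.jacobiDefect_newY ha hb hI hJ, Finset.sum_eq_zero, smul_zero]
    exact fun i _ => Finset.sum_eq_zero fun j _ => (invJacobi_iff _ _ _ _).1 (h _ _) _ _ _ _
  · intro h
    -- Induction on the total nilpotency order: applying L(1)^i/i! lowers the order from I to I − i,
    -- so every summand except i = j = 0 vanishes by hypothesis.
    have key : ∀ N I J : ℕ, I + J ≤ N → ∀ p q : ℤ, ∀ a ∈ A.gr p, ∀ b ∈ A.gr q,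
        (∀ j, I ≤ j → A.dpow j a = 0) → (∀ j, J ≤ j → A.dpow j b = 0) →
        ∀ w l m n, invDefect A.Y YW w l m n a b = 0 := by
      intro N
      induction N with
      | zero =>
        intro I J hIJ p q a ha b hb hI hJ w l m n
        have := hI 0 (by omega)
        rw [dpow_zero] at this
        rw [this, map_zero, AddMonoidHom.zero_apply]
      | succ N ih =>
        intro I J hIJ p q a ha b hb hI hJ w l m n
        rcases Nat.eq_zero_or_pos I with hI0 | hI0
        · have := hI 0 (by omega)
          rw [dpow_zero] at this
          rw [this, map_zero, AddMonoidHom.zero_apply]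
        rcases Nat.eq_zero_or_pos J with hJ0 | hJ0
        · have := hJ 0 (by omega)
          rw [dpow_zero] at this
          rw [this, map_zero]
        have hd : ∀ {c : V} {K : ℕ}, (∀ j, K ≤ j → A.dpow j c = 0) → ∀ i j, K - i ≤ j →
            A.dpow j (A.dpow i c) = 0 := fun hK i j hj => by
          rw [dpow_dpow, hK _ (by omega), smul_zero]
        -- m ↦ 2p − m − l − 1 is an involution, so the surviving summand sits at (m, n).
        have h2 := h w l (2 * p - m - l - 1) (2 * q - n - l - 1) a b
        have hz : ∀ i j : ℕ, i < I → j < J → (i, j) ≠ (0, 0) → ∀ m n,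
            invDefect A.Y YW w l m n (A.dpow i a) (A.dpow j b) = 0 := fun i j hi hj hij m n =>
          ih (I - i) (J - j) (by
            have : ¬ (i = 0 ∧ j = 0) := fun h => hij (by rw [h.1, h.2])
            omega) _ _ _ (A.dpow_mem_gr ha i) _ (A.dpow_mem_gr hb j) (hd hI i) (hd hJ j) w l m n
        rw [A.jacobiDefect_newY ha hb hI hJ, Finset.sum_eq_single_of_mem 0 (by simpa using hI0)
          fun i hi hi0 => Finset.sum_eq_zero fun j hj => hz i j (Finset.mem_range.1 hi)
            (Finset.mem_range.1 hj) (fun h => hi0 (Prod.mk.inj h).1) _ _,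
          Finset.sum_eq_single_of_mem 0 (by simpa using hJ0)
          fun j hj hj0 => hz 0 j hI0 (Finset.mem_range.1 hj) (fun h => hj0 (Prod.mk.inj h).2) _ _,
          dpow_zero, dpow_zero, neg_smul, neg_eq_zero, ← Units.smul_def, smul_eq_zero_iff_eq] at h2
        rw [← h2]
        congr 3
        · push_cast; ring
        · push_cast; ring
    intro a b
    rw [invJacobi_iff]
    intro w l m n
    refine A.biadditive_eq_zero _ (fun p q a ha b hb => ?_) a b
    obtain ⟨I, hI⟩ := A.exists_dpow_eq_zero a
    obtain ⟨J, hJ⟩ := A.exists_dpow_eq_zero b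
    exact key _ I J le_rfl p q a ha b hb hI hJ w l m n

end VertexOperatorAlgebra

end VertexOp

namespace VertexOp

namespace VertexOperatorAlgebra

variable {V : Type u} [AddCommGroup V] [Module ℂ V] (A : VertexOperatorAlgebra V)
  {W : Type v} [AddCommGroup W] [Module ℂ W]

/-! ### The inverse of `Y_W ↦ Y_W^new` -/

/-- `Y_W(e^{x⁻¹L(1)} (-x²)^{L(0)} v, x)`. -/
noncomputable def oldY (YW : V →ₗ[ℂ] VertexOperator ℂ W) : V →ₗ[ℂ] VertexOperator ℂ W :=
  (Finsupp.lsum ℂ fun i : ℤ =>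
    (LinearMap.lsmul (LaurentSeries ℂ) (HahnModule ℤ ℂ W)
      (HahnSeries.single (-i) 1) |>.restrictScalars ℂ).compRight ℂ ∘ₗ YW).comp A.Phi

theorem coeff_oldY (YW : V →ₗ[ℂ] VertexOperator ℂ W) (a : V) (n : ℤ) (w : W) :
    HVertexOperator.coeff (A.oldY YW a) n w
      = Finsupp.lsum ℂ (fun i => coeffLin YW (n + i) w) (A.Phi a) := by
  have h : ∀ (d : ℤ →₀ V), HVertexOperator.coeff ((Finsupp.lsum ℂ fun i : ℤ =>
      (LinearMap.lsmul (LaurentSeries ℂ) (HahnModule ℤ ℂ W)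
        (HahnSeries.single (-i) 1) |>.restrictScalars ℂ).compRight ℂ ∘ₗ YW) d) n w
      = Finsupp.lsum ℂ (fun i => coeffLin YW (n + i) w) d := by
    intro d
    induction d using Finsupp.induction_linear with
    | zero => simp
    | add f g hf hg =>
      rw [map_add, map_add, map_add, ← hf, ← hg]
      rfl
    | single i b =>
      rw [Finsupp.lsum_single, Finsupp.lsum_single]
      change ((HahnModule.of ℂ).symm (HahnSeries.single (-i) (1 : ℂ) • (YW b w))).coeff n
        = ((HahnModule.of ℂ).symm (YW b w)).coeff (n + i)
      have := HahnModule.coeff_single_smul_vadd (r := (1 : ℂ)) (x := YW b w) (a := n + i) (b := -i)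
      simpa using this
  exact h (A.Phi a)

theorem coeff_oldY_of_mem {p : ℤ} {a : V} (ha : a ∈ A.gr p) (YW : V →ₗ[ℂ] VertexOperator ℂ W)
    (n : ℤ) (w : W) : HVertexOperator.coeff (A.oldY YW a) n w
      = (p.negOnePow : ℤ) • ∑ᶠ j : ℕ, HVertexOperator.coeff (YW (A.dpow j a)) (n - 2 * p + j) w := by
  rw [A.coeff_oldY, A.lsum_Phi ha]
  congr 1
  refine finsum_congr fun j => ?_
  change HVertexOperator.coeff _ _ _ = _
  rw [show n + (j - 2 * p) = n - 2 * p + j by ring]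

theorem sum_antidiagonal_neg_one_pow_choose (N : ℕ) :
    ∑ ij ∈ Finset.HasAntidiagonal.antidiagonal N, ((-1) ^ ij.1 * ((ij.1 + ij.2).choose ij.1) : ℤ)
      = if N = 0 then 1 else 0 := by
  rw [← Int.alternating_sum_range_choose, Finset.Nat.sum_antidiagonal_eq_sum_range_succ
    (f := fun i j => ((-1) ^ i * ((i + j).choose i) : ℤ))]
  refine Finset.sum_congr rfl fun i hi => ?_
  rw [Finset.mem_range] at hi
  rw [show i + (N - i) = N by omega]

/-- The composite of two mutually inverse changes of variables. -/
theorem comp_eq (p : ℤ) (a : V) {M : Type*} [AddCommGroup M] (g : ℕ → V →+ M) :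
    (p.negOnePow : ℤ) • ∑ᶠ i : ℕ, ((p - i).negOnePow : ℤ) • ∑ᶠ j : ℕ,
      g (i + j) (A.dpow j (A.dpow i a)) = g 0 a := by
  obtain ⟨I, hI⟩ := A.exists_dpow_eq_zero a
  -- L(1)^i lowers the weight to p − i. The two weight signs therefore leave (−1)^i, as in
  -- e^{−T}e^{T} = 1.
  have h1 : ∀ i : ℕ, ((p - i).negOnePow : ℤ) • ∑ᶠ j : ℕ, g (i + j) (A.dpow j (A.dpow i a))
      = (p.negOnePow : ℤ) • ∑ᶠ j : ℕ, ((-1) ^ i * ((i + j).choose i) : ℤ) •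
        g (i + j) (A.dpow (i + j) a) := by
    intro i
    have e : ∀ j, A.dpow j (A.dpow i a) = ((i + j).choose i : ℤ) • A.dpow (i + j) a := fun j => by
      rw [dpow_dpow, add_comm j i, Nat.choose_symm_add]
    simp only [e]
    rw [zsmul_finsum _ (hasFiniteSupport_of_le (N := I) fun j hj => by
      rw [hI _ (by omega), smul_zero, map_zero]), zsmul_finsum _ (hasFiniteSupport_of_le (N := I)
      fun j hj => by rw [hI _ (by omega), map_zero, smul_zero])]
    refine finsum_congr fun j => ?_
    rw [map_zsmul, smul_smul, smul_smul, Int.negOnePow_sub, Units.val_mul,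
      Int.coe_negOnePow_natCast, mul_assoc]
  rw [finsum_congr h1, ← zsmul_finsum _ (hasFiniteSupport_of_le (N := I) fun i hi =>
    finsum_eq_zero_of_forall fun j => by rw [hI _ (by omega), map_zero, smul_zero]), smul_smul,
    ← Units.val_mul, ← Int.negOnePow_add, Int.negOnePow_even _ ⟨p, rfl⟩, Units.val_one, one_smul,
    ← finsum_sum_antidiagonal (N := I) fun i j hij => by rw [hI _ hij, map_zero, smul_zero]]
  have h2 : ∀ N : ℕ, ∑ ij ∈ Finset.HasAntidiagonal.antidiagonal N,
      ((-1) ^ ij.1 * ((ij.1 + ij.2).choose ij.1) : ℤ) • g (ij.1 + ij.2) (A.dpow (ij.1 + ij.2) a)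
      = (if N = 0 then 1 else 0 : ℤ) • g N (A.dpow N a) := by
    intro N
    rw [← sum_antidiagonal_neg_one_pow_choose, Finset.sum_smul]
    refine Finset.sum_congr rfl fun ij hij => ?_
    rw [Finset.HasAntidiagonal.mem_antidiagonal] at hij
    rw [hij]
  rw [finsum_congr h2, finsum_eq_single _ 0 fun N hN => by rw [if_neg hN, zero_smul], if_pos rfl,
    one_smul, dpow_zero]

theorem ext_of_gr {Y₁ Y₂ : V →ₗ[ℂ] VertexOperator ℂ W} (h : ∀ p, ∀ a ∈ A.gr p, ∀ n w,
    HVertexOperator.coeff (Y₁ a) n w = HVertexOperator.coeff (Y₂ a) n w) : Y₁ = Y₂ := by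
  refine LinearMap.ext fun a => A.gr_induction (P := fun a => Y₁ a = Y₂ a) (by simp)
    (fun a b ha hb => by rw [map_add, map_add, ha, hb]) (fun p a ha => ?_) a
  apply HVertexOperator.coeff_inj
  funext n
  ext w
  exact h p a ha n w

theorem oldY_newY (YW : V →ₗ[ℂ] VertexOperator ℂ W) : A.oldY (A.newY YW) = YW := by
  refine A.ext_of_gr fun p a ha n w => ?_
  rw [A.coeff_oldY_of_mem ha]
  refine Eq.trans ?_ (A.comp_eq p a fun i => (coeffLin YW (n - i) w).toAddMonoidHom) |>.trans ?_
  · congr 1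
    refine finsum_congr fun i => ?_
    rw [A.coeff_newY_of_mem (A.dpow_mem_gr ha i)]
    congr 1
    refine finsum_congr fun j => ?_
    change HVertexOperator.coeff _ _ _ = HVertexOperator.coeff _ _ _
    push_cast
    rw [show n - 2 * p + i + 2 * (p - i) - (j : ℤ) = n - (i + j) by ring]
  · change HVertexOperator.coeff _ _ _ = _
    rw [Nat.cast_zero, sub_zero]

theorem newY_oldY (YW : V →ₗ[ℂ] VertexOperator ℂ W) : A.newY (A.oldY YW) = YW := by
  refine A.ext_of_gr fun p a ha n w => ?_
  rw [A.coeff_newY_of_mem ha]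
  refine Eq.trans ?_ (A.comp_eq p a fun i => (coeffLin YW (n + i) w).toAddMonoidHom) |>.trans ?_
  · congr 1
    refine finsum_congr fun i => ?_
    rw [A.coeff_oldY_of_mem (A.dpow_mem_gr ha i)]
    congr 1
    refine finsum_congr fun j => ?_
    change HVertexOperator.coeff _ _ _ = HVertexOperator.coeff _ _ _
    push_cast
    rw [show n + 2 * p - i - 2 * (p - i) + (j : ℤ) = n + (i + j) by ring]
  · change HVertexOperator.coeff _ _ _ = _
    rw [Nat.cast_zero, add_zero]

end VertexOperatorAlgebra

/-! ### The isomorphism of categories. -/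

section Functors

variable {V : Type u} [AddCommGroup V] [Module ℂ V] (A : VertexOperatorAlgebra V)

/-- The assignment `(W, Y_W) ↦ (W, Y_W^old)`, identical on linear maps. -/
noncomputable def oldFunctor : FieldSpace.{u, v} V ⥤ FieldSpace.{u, v} V where
  obj M := { W := M.W, YW := A.oldY M.YW }
  map {M N} f :=
    { map := f.map
      comm := fun a n w => by
        simp only [A.coeff_oldY, Finsupp.lsum_apply, Finsupp.sum, map_sum]
        exact Finset.sum_congr rfl fun i _ => f.comm _ _ _ }

/-- The round trip returns an object only up to a propositional equality of vertex operator maps, so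
morphisms are compared by `HEq`. The carrier and the linear map are unchanged definitionally, and
`HEq.rfl` then applies. -/
theorem FieldSpace.hom_heq {M₁ M₂ N₁ N₂ : FieldSpace.{u, v} V} (hM : M₁ = M₂) (hN : N₁ = N₂)
    (f : M₁ ⟶ N₁) (g : M₂ ⟶ N₂)
    (h : HEq (FieldSpace.Hom.map f) (FieldSpace.Hom.map g)) : HEq f g := by
  subst hM hN
  exact heq_of_eq (FieldSpace.Hom.ext (eq_of_heq h))

theorem oldFunctor_obj_newFunctor_obj (M : FieldSpace.{u, v} V) :
    (oldFunctor A).obj ((newFunctor A).obj M) = M := by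
  cases M
  simp only [oldFunctor, newFunctor, A.oldY_newY]

theorem newFunctor_obj_oldFunctor_obj (M : FieldSpace.{u, v} V) :
    (newFunctor A).obj ((oldFunctor A).obj M) = M := by
  cases M
  simp only [oldFunctor, newFunctor, A.newY_oldY]

theorem newFunctor_comp_oldFunctor : newFunctor.{u, v} A ⋙ oldFunctor A = 𝟭 _ :=
  CategoryTheory.Functor.hext (oldFunctor_obj_newFunctor_obj A) fun M N _ =>
    FieldSpace.hom_heq (oldFunctor_obj_newFunctor_obj A M) (oldFunctor_obj_newFunctor_obj A N) _ _
      HEq.rfl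

theorem oldFunctor_comp_newFunctor : oldFunctor.{u, v} A ⋙ newFunctor A = 𝟭 _ :=
  CategoryTheory.Functor.hext (newFunctor_obj_oldFunctor_obj A) fun M N _ =>
    FieldSpace.hom_heq (newFunctor_obj_oldFunctor_obj A M) (newFunctor_obj_oldFunctor_obj A N) _ _
      HEq.rfl

theorem isModule_newFunctor_obj (M : PhiModCat.{u, v} phi A.toVertexAlgebra) :
    IsModule A.toVertexAlgebra ((newFunctor A).obj M.obj).YW :=
  (A.isPhiModule_iff_isModule_newY _ M.property.vacuum).1 M.property

theorem isPhiModule_oldFunctor_obj (M : ModCat.{u, v} A.toVertexAlgebra) :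
    IsPhiModule phi A.toVertexAlgebra ((oldFunctor A).obj M.obj).YW := by
  have h : A.newY ((oldFunctor A).obj M.obj).YW = M.obj.YW := A.newY_oldY _
  have h0 : IsVacuum A.one ((oldFunctor A).obj M.obj).YW := by
    rw [← A.isVacuum_newY_iff, h]
    exact M.property.vacuum
  rw [A.isPhiModule_iff_isModule_newY _ h0, h]
  exact M.property

/-- The inclusion is faithful and injective on objects, hence cancellable on the right. -/
theorem fullSubcategory_functor_ext {C D : Type*} [Category C] [Category D] {P : ObjectProperty D}
    {F G : C ⥤ P.FullSubcategory} (h : F ⋙ P.ι = G ⋙ P.ι) : F = G := by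
  refine CategoryTheory.Functor.ext
    (fun X => ObjectProperty.FullSubcategory.ext (CategoryTheory.Functor.congr_obj h X))
    fun X Y f => P.ι.map_injective ?_
  rw [Functor.map_comp, Functor.map_comp, eqToHom_map, eqToHom_map]
  exact CategoryTheory.Functor.congr_hom h f

end Functors

end VertexOp

theorem proposition3p8 {V : Type u} [AddCommGroup V] [Module ℂ V]
    (A : VertexOp.VertexOperatorAlgebra V) :
    (∀ (W : Type v) [AddCommGroup W] [Module ℂ W] (YW : V →ₗ[ℂ] VertexOperator ℂ W),
      VertexOp.IsVacuum A.one YW →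
        (VertexOp.IsPhiModule VertexOp.phi A.toVertexAlgebra YW ↔
          VertexOp.IsModule A.toVertexAlgebra (A.newY YW))) ∧
    ∃ (F : VertexOp.PhiModCat.{u, v} VertexOp.phi A.toVertexAlgebra ⥤
          VertexOp.ModCat.{u, v} A.toVertexAlgebra)
      (G : VertexOp.ModCat.{u, v} A.toVertexAlgebra ⥤
          VertexOp.PhiModCat.{u, v} VertexOp.phi A.toVertexAlgebra),
      F ⋙ ObjectProperty.ι _ = ObjectProperty.ι _ ⋙ VertexOp.newFunctor.{u, v} A ∧
      F ⋙ G = 𝟭 _ ∧ G ⋙ F = 𝟭 _ := by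
  refine ⟨fun W _ _ YW h0 => A.isPhiModule_iff_isModule_newY YW h0,
    ObjectProperty.lift _ (ObjectProperty.ι _ ⋙ VertexOp.newFunctor A)
      (VertexOp.isModule_newFunctor_obj A),
    ObjectProperty.lift _ (ObjectProperty.ι _ ⋙ VertexOp.oldFunctor A)
      (VertexOp.isPhiModule_oldFunctor_obj A), rfl, ?_, ?_⟩
  · exact VertexOp.fullSubcategory_functor_ext
      (congrArg (ObjectProperty.ι _ ⋙ ·) (VertexOp.newFunctor_comp_oldFunctor A))
  · exact VertexOp.fullSubcategory_functor_ext
      (congrArg (ObjectProperty.ι _ ⋙ ·) (VertexOp.oldFunctor_comp_newFunctor A))
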